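/- Let $\mathbb K$ be a field of characteristic zero and $V=\bigoplus_{j\in\mathbb Z}V_j$ a finite-dimensional graded vector space with homogeneous basis $\{e_a\}$. Let $t^a$ be variables of degree $|t^a|=-|e_a|$ and $\psi_a$ variables of degree $|\psi_a|=1-|t^a|$. The functions on the formal graded manifold $V$ are the graded-commutative power series $\mathcal O_V=\mathbb K[[t^a]]$, and the polyvector fields are the graded-commutative power series $\wedge^\bullet\mathcal T_V=\mathbb K[[t^a,\psi_a]]$. The weight of a monomial is its number of $\psi$'s, and $\wedge^{\bullet\ge1}\mathcal T_V$ consists of the polyvector fields without terms of weight $0$. For homogeneous polyvector fields put $$A\bullet B=\sum_a\frac{\partial A}{\partial\psi_a}\frac{\partial B}{\partial t^a},\qquad [A,B]_S=A\bullet B+(-1)^{|A||B|+|A|+|B|}B\bullet A,$$ with $\partial/\partial\psi_a$ acting from the right and $\partial/\partial t^a$ from the left. A polyvector field $\Gamma\in\wedge^{\bullet\ge 1}\mathcal T_V$ is an extended Poisson structure if it is homogeneous of degree $2$ and $[\Gamma,\Gamma]_S=0$. Let $\Gamma\in\wedge^{\bullet\ge1}\mathcal T_V$ and write its weight $n$ part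 as $\Gamma_n=\frac1{n!}\sum\Gamma^{a_1\dots a_n}(t)\,\psi_{a_1}\cdots\psi_{a_n}$ with graded symmetric components (that is, $\Gamma^{a_1\dots a_n}$ is obtained from $\Gamma_n$ by differentiating from the right by $\psi_{a_n}$, then $\psi_{a_{n-1}}$, …, then $\psi_{a_1}$). The brackets $L_n(f_1,\dots,f_n)=\Gamma_n\,df_1\wedge\dots\wedge df_n$ are the multilinear maps $L_n:\mathcal O_V^{\otimes n}\to\mathcal O_V$ given on homogeneous $f_i$ by $$L_n(f_1,\dots,f_n)=(-1)^{\frac{n(n-1)}2}\sum_{a_1,\dots,a_n}(-1)^{\epsilon}\,\Gamma^{a_1\dots a_n}(t)\,(\partial_{a_1}f_1)\cdots(\partial_{a_n}f_n),\qquad \epsilon=\sum_{k=1}^n|t^{a_k}|\bigl(|f_1|+\dots+|f_{k-1}|+k-1\bigr),$$ with left derivatives $\partial_a=\partial/\partial t^a$. Then, for all homogeneous functions $f_i,g,h$: 1. Each $L_n$ is graded skew-symmetric: $L_n(f_{\sigma(1)},\dots,f_{\sigma(n)})=\epsilon(\sigma)\,\mathrm{sgn}(\sigma)\,L_n(f_1,\dots,f_n)$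 for every permutation $\sigma$, where $\epsilon(\sigma)$ is the Koszul sign. 2. Each $L_n$ has the graded Leibniz property in each argument. With $gh$, $g$ or $h$ in the $j$-th place, $1\le j\le n$: $$L_n(\dots,gh,\dots)=(-1)^{|g|(|h|+\sum_{i>j}|f_i|)}L_n(\dots,h,\dots)\,g+(-1)^{|h|\sum_{i>j}|f_i|}L_n(\dots,g,\dots)\,h,$$ and, if $\Gamma$ is homogeneous of degree $k$, $$L_n(\dots,gh,\dots)=(-1)^{|g|(k-n+\sum_{i<j}|f_i|)}\,g\,L_n(\dots,h,\dots)+(-1)^{|h|\sum_{i>j}|f_i|}L_n(\dots,g,\dots)\,h.$$ 3. The brackets $\{L_n\}_{n\ge1}$ (with $L_0=0$) make $\mathcal O_V$ an $L_\infty$ algebra if and only if $\Gamma$ is an extended Poisson structure. Here an $L_\infty$ algebra structure consists of graded skew-symmetric $n$-ary operations $l_n$ of degree $2-n$ on the homogeneous elements such that for all $n$ and all homogeneous $v_1,\dots,v_n$ $$\sum_{r+s=n+1}\ \sum_{\sigma}\epsilon(\sigma)\,\mathrm{sgn}(\sigma)\,(-1)^{r(s-1)}\,l_r\bigl(l_s(v_{\sigma(1)},\dots,v_{\sigma(s)}),v_{\sigma(s+1)},\dots,v_{\sigma(n)}\bigr)=0,$$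 $\sigma$ running over the $(s,n-s)$-unshuffles. -/

import Mathlib

open Finset

noncomputable section

namespace FormalGraded

/-! ### Graded-commutative formal power series -/

section Series

variable {J : Type*} [LinearOrder J] {K : Type*} [Field K]

/-- For graded variables `x_a` of degree `w a`, the exponent `m` is admissible if every odd
variable occurs at most once. The admissible `m` index the monomials
`x^m = ∏ x_a ^ (m a)` (factors in increasing order of `a`); odd variables square to zero. -/
def IsAdmissible (w : J → ℤ) (m : J →₀ ℕ) : Prop := ∀ a, Odd (w a) → m a ≤ 1

/-- The degree `∑ (m a) * (w a)` of the monomial `x^m`. -/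
def monomialDegree (w : J → ℤ) (m : J →₀ ℕ) : ℤ := m.sum fun a k => (k : ℤ) * w a

/-- The graded-commutative power series ring `K⟦x_a⟧` on variables `x_a` of degree `w a`:
a series is the family of its coefficients at the monomials `x^m`, `m` admissible. -/
def SuperSeries (K : Type*) [Field K] (w : J → ℤ) : Type _ :=
  {m : J →₀ ℕ // IsAdmissible w m} → K

variable {w : J → ℤ}

instance : AddCommGroup (SuperSeries K w) :=
  inferInstanceAs (AddCommGroup ({m : J →₀ ℕ // IsAdmissible w m} → K))

instance : Module K (SuperSeries K w) :=
  inferInstanceAs (Module K ({m : J →₀ ℕ // IsAdmissible w m} → K))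

namespace SuperSeries

open Classical in
/-- The coefficient at `x^m`, for every exponent `m` (zero if `x^m = 0`). -/
def coeff (m : J →₀ ℕ) : SuperSeries K w →ₗ[K] K where
  toFun f := if h : IsAdmissible w m then f ⟨m, h⟩ else 0
  map_add' f g := by
    by_cases h : IsAdmissible w m
    · simp only [h, dite_true]; rfl
    · simp [h]
  map_smul' c f := by
    by_cases h : IsAdmissible w m
    · simp only [h, dite_true]; rfl
    · simp [h]

/-- The linear map with prescribed coefficient functionals. -/
def ofCoeffs {M : Type*} [AddCommGroup M] [Module K M] (c : (J →₀ ℕ) → M →ₗ[K] K) :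
    M →ₗ[K] SuperSeries K w where
  toFun f := fun m => c m.1 f
  map_add' f g := funext fun m => (c m.1).map_add f g
  map_smul' r f := funext fun m => (c m.1).map_smul r f

/-- The sign in `x^m * x^n = ± x^(m+n)`: each `x_a` of `x^m` passes each `x_b` of `x^n` with
`b < a`. -/
def mulSign (w : J → ℤ) (m n : J →₀ ℕ) : ℤˣ :=
  (m.sum fun a k => n.sum fun b l =>
    if b < a then ((k : ℤ) * w a) * ((l : ℤ) * w b) else 0).negOnePow

/-- Multiplication of graded-commutative power series, as a bilinear map. -/
def mulHom : SuperSeries K w →ₗ[K] SuperSeries K w →ₗ[K] SuperSeries K w :=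
  LinearMap.mk₂ K
    (fun f g m => ∑ p ∈ antidiagonal m.1,
      mulSign w p.1 p.2 • (coeff p.1 f * coeff p.2 g))
    (fun f f' g => funext fun m => by
      refine Eq.trans ?_ sum_add_distrib
      exact sum_congr rfl fun p _ => by rw [map_add, add_mul, smul_add])
    (fun c f g => funext fun m => by
      refine Eq.trans ?_ (mul_sum _ _ c).symm
      exact sum_congr rfl fun p _ => by
        rw [map_smul, smul_eq_mul, mul_assoc, mul_smul_comm])
    (fun f g g' => funext fun m => by
      refine Eq.trans ?_ sum_add_distrib
      exact sum_congr rfl fun p _ => by rw [map_add, mul_add, smul_add])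
    (fun c f g => funext fun m => by
      refine Eq.trans ?_ (mul_sum _ _ c).symm
      exact sum_congr rfl fun p _ => by
        rw [map_smul, smul_eq_mul, mul_left_comm, mul_smul_comm])

instance : Mul (SuperSeries K w) := ⟨fun f g => mulHom f g⟩

/-- The left partial derivative `∂/∂x_a`:
`x^m ↦ (-1)^(|x_a| ∑_{b<a} (m b)|x_b|) (m a) x^(m - a)`. -/
def derivLeft (a : J) : SuperSeries K w →ₗ[K] SuperSeries K w :=
  ofCoeffs fun m =>
    ((w a * m.sum fun b k => if b < a then (k : ℤ) * w b else 0).negOnePow : ℤˣ) •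
      ((m a + 1 : K) • coeff (m + Finsupp.single a 1))

/-- The right partial derivative with respect to `x_a` (`x_a` is removed from the right):
`x^m ↦ (-1)^(|x_a| ∑_{b>a} (m b)|x_b|) (m a) x^(m - a)`. -/
def derivRight (a : J) : SuperSeries K w →ₗ[K] SuperSeries K w :=
  ofCoeffs fun m =>
    ((w a * m.sum fun b k => if a < b then (k : ℤ) * w b else 0).negOnePow : ℤˣ) •
      ((m a + 1 : K) • coeff (m + Finsupp.single a 1))

/-- The linear map `f ↦ (-1)^(c|f|) f` (for homogeneous `f`). -/
def twist (c : ℤ) : SuperSeries K w →ₗ[K] SuperSeries K w :=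
  ofCoeffs fun m => ((c * monomialDegree w m).negOnePow : ℤˣ) • coeff m

/-- The homogeneous series of degree `d`. -/
def homogeneous (K : Type*) [Field K] (w : J → ℤ) (d : ℤ) : Submodule K (SuperSeries K w) where
  carrier := {f | ∀ m, monomialDegree w m ≠ d → coeff m f = 0}
  add_mem' hf hg m hm := by rw [map_add, hf m hm, hg m hm, add_zero]
  zero_mem' m _ := map_zero _
  smul_mem' c f hf m hm := by rw [map_smul, hf m hm, smul_zero]

/-- `(c, f_1, …, f_n) ↦ c f_1 ⋯ f_n`. -/
def prodHom : (n : ℕ) → SuperSeries K w →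
    MultilinearMap K (fun _ : Fin n => SuperSeries K w) (SuperSeries K w)
  | 0, c => MultilinearMap.constOfIsEmpty K _ c
  | n + 1, c =>
    MultilinearMap.uncurryRight (M := fun _ : Fin (n + 1) => SuperSeries K w)
      (mulHom.compMultilinearMap (prodHom n c))

end SuperSeries

end Series

/-! ### `L_∞` algebras -/

section LInfinity

variable {K : Type*} [Field K] {A : Type*} [AddCommGroup A] [Module K A]

/-- `ε(σ) sgn(σ)`: the Koszul sign of `v_1 ⋯ v_n ↦ v_σ(1) ⋯ v_σ(n)` for `v_i` of degree `d i`,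
times the sign of `σ`. -/
def skewKoszulSign {n : ℕ} (d : Fin n → ℤ) (σ : Equiv.Perm (Fin n)) : ℤˣ :=
  (∏ i, ∏ j, if i < j ∧ σ j < σ i then (d (σ i) * d (σ j)).negOnePow else 1) *
    Equiv.Perm.sign σ

/-- `σ` is an `(s, n-s)`-unshuffle: `σ(1) < ⋯ < σ(s)` and `σ(s+1) < ⋯ < σ(n)`. -/
def IsUnshuffle {n : ℕ} (s : ℕ) (σ : Equiv.Perm (Fin n)) : Prop :=
  StrictMonoOn σ {i | (i : ℕ) < s} ∧ StrictMonoOn σ {i | s ≤ (i : ℕ)}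

/-- An `n`-ary operation is graded skew-symmetric, `𝒜 k` being the elements of degree `k`. -/
def IsGradedSkew (𝒜 : ℤ → Submodule K A) {n : ℕ}
    (l : MultilinearMap K (fun _ : Fin n => A) A) : Prop :=
  ∀ (d : Fin n → ℤ) (v : Fin n → A), (∀ i, v i ∈ 𝒜 (d i)) →
    ∀ σ : Equiv.Perm (Fin n), l (fun i => v (σ i)) = skewKoszulSign d σ • l v

open Classical in
/-- The generalized Jacobi expression
`∑_{r+s=n+1} ∑_σ ε(σ) sgn(σ) (-1)^(r(s-1)) l_r(l_s(v_σ(1),…,v_σ(s)), v_σ(s+1),…,v_σ(n))`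
over `(s, n-s)`-unshuffles `σ`, for `v_i` of degree `d i`. -/
def jacobiator (l : ∀ n : ℕ, MultilinearMap K (fun _ : Fin n => A) A) {n : ℕ}
    (d : Fin n → ℤ) (v : Fin n → A) : A :=
  ∑ s : Fin (n + 1), ∑ σ : Equiv.Perm (Fin n) with IsUnshuffle (s : ℕ) σ,
    (skewKoszulSign d σ * ((((n - (s : ℕ) + 1 : ℕ) : ℤ)) * (((s : ℕ) : ℤ) - 1)).negOnePow) •
      l (n - (s : ℕ) + 1)
        (Fin.cons (l (s : ℕ) fun i => v (σ ⟨i, by omega⟩))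
          fun k : Fin (n - (s : ℕ)) => v (σ ⟨(s : ℕ) + k, by omega⟩))

/-- The operations `l_n` are an `L_∞` algebra structure on the graded vector space with graded
pieces `𝒜 k`. -/
structure IsLInfinity (𝒜 : ℤ → Submodule K A)
    (l : ∀ n : ℕ, MultilinearMap K (fun _ : Fin n => A) A) : Prop where
  skew : ∀ n, IsGradedSkew 𝒜 (l n)
  degree : ∀ (n : ℕ) (d : Fin n → ℤ) (v : Fin n → A), (∀ i, v i ∈ 𝒜 (d i)) →
    l n v ∈ 𝒜 ((∑ i, d i) + (2 - n))
  jacobi : ∀ (n : ℕ) (d : Fin n → ℤ) (v : Fin n → A), (∀ i, v i ∈ 𝒜 (d i)) →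
    jacobiator l d v = 0

end LInfinity

/-! ### Functions, polyvector fields and brackets on a formal graded manifold -/

section Manifold

open SuperSeries

variable {ι : Type*} [Fintype ι] [LinearOrder ι] {K : Type*} [Field K] {w : ι → ℤ}

/-- The structure sheaf `𝒪_V = K⟦t^a⟧`, with coordinates `t^a` of degree `w a`. -/
abbrev Functions (K : Type*) [Field K] (w : ι → ℤ) := SuperSeries K w

/-- The degrees of the variables `t^a` (left copy of `ι`) and `ψ_a = s ∂/∂t^a` (right copy):
`|ψ_a| = 1 - |t^a|`. -/
def polyDegree (w : ι → ℤ) (x : ι ⊕ₗ ι) : ℤ := Sum.elim w (fun a => 1 - w a) (ofLex x)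

/-- The polyvector fields `∧^• 𝒯_V = K⟦t^a, ψ_a⟧`; monomials are written with the `t`'s on the
left of the `ψ`'s. -/
abbrev Polyvector (K : Type*) [Field K] (w : ι → ℤ) := SuperSeries K (polyDegree w)

/-- The variable `t^a` among the `t`'s and `ψ`'s. -/
def tVar (a : ι) : ι ⊕ₗ ι := toLex (Sum.inl a)

/-- The variable `ψ_a` among the `t`'s and `ψ`'s. -/
def psiVar (a : ι) : ι ⊕ₗ ι := toLex (Sum.inr a)

/-- The weight (polyvector degree) of a monomial: its number of `ψ`'s. -/
def weight (m : ι ⊕ₗ ι →₀ ℕ) : ℕ := ∑ a, m (psiVar a)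

/-- `Γ ∈ ∧^{• ≥ 1} 𝒯_V`. -/
def HasPositiveWeight (Γ : Polyvector K w) : Prop := ∀ m, weight m = 0 → coeff m Γ = 0

/-- `A • B = ∑_a (∂A/∂ψ_a) (∂B/∂t^a)`, the `ψ`-derivative acting from the right and the
`t`-derivative from the left. -/
def bullet (A B : Polyvector K w) : Polyvector K w :=
  ∑ a, derivRight (psiVar a) A * derivLeft (tVar a) B

/-- The odd Schouten bracket `A • B + (-1)^(|A||B|+|A|+|B|) B • A` of polyvector fields `A`, `B`
of degrees `p`, `q`. -/
def schouten (p q : ℤ) (A B : Polyvector K w) : Polyvector K w :=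
  bullet A B + (p * q + p + q).negOnePow • bullet B A

/-- Extended Poisson structures. -/
structure IsExtendedPoisson (Γ : Polyvector K w) : Prop where
  positive : HasPositiveWeight Γ
  degree : Γ ∈ homogeneous K (polyDegree w) 2
  schouten_eq_zero : schouten 2 2 Γ Γ = 0

/-- The weight zero part of a polyvector field, as a function (`ψ = 0`). -/
def weightZero : Polyvector K w →ₗ[K] Functions K w :=
  ofCoeffs fun m => coeff (m.mapDomain tVar)

/-- The components `Γ^{a_1…a_n}(t)` of `Γ`: the weight `n` part of `Γ` is
`Γ_n = (1/n!) ∑ Γ^{a_1…a_n}(t) ψ_{a_1}⋯ψ_{a_n}` with graded symmetric components. They are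
obtained by differentiating from the right by `ψ_{a_n}`, …, `ψ_{a_1}` and setting `ψ = 0`. -/
def component : (n : ℕ) → (Fin n → ι) → Polyvector K w →ₗ[K] Functions K w
  | 0, _ => weightZero
  | n + 1, a => component n (Fin.init a) ∘ₗ derivRight (psiVar (a (Fin.last n)))

/-- The bracket `L_n(f_1,…,f_n) = Γ_n df_1 ∧ ⋯ ∧ df_n`, i.e. for homogeneous `f_i`
`(-1)^(n(n-1)/2) ∑ (-1)^ε Γ^{a_1…a_n} (∂_{a_1} f_1) ⋯ (∂_{a_n} f_n)` with
`ε = ∑_k |t^{a_k}| (|f_1| + ⋯ + |f_{k-1}| + k - 1)`; see `bracket_apply`. -/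
def bracket (Γ : Polyvector K w) (n : ℕ) :
    MultilinearMap K (fun _ : Fin n => Functions K w) (Functions K w) :=
  ∑ a : Fin n → ι,
    (((n.choose 2 : ℤ) + ∑ k : Fin n, w (a k) * (k : ℕ)).negOnePow : ℤˣ) •
      (prodHom n (component n a Γ)).compLinearMap fun i =>
        derivLeft (a i) ∘ₗ twist (∑ k with i < k, w (a k))

/-- The twist multiplies homogeneous elements by a sign. -/
theorem twist_of_mem {d : ℤ} {f : Functions K w} (hf : f ∈ homogeneous K w d) (c : ℤ) :
    twist c f = (c * d).negOnePow • f := by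
  funext m
  change (c * monomialDegree w m.1).negOnePow • coeff m.1 f = (c * d).negOnePow • f m
  have h1 : coeff m.1 f = f m := dif_pos m.2
  by_cases hm : monomialDegree w m.1 = d
  · rw [hm, h1]
  · have h0 := hf m.1 hm
    rw [h0, smul_zero, ← h1, h0, smul_zero]

/-- The bracket of homogeneous functions in coordinates. -/
theorem bracket_apply (Γ : Polyvector K w) (n : ℕ) (d : Fin n → ℤ) (f : Fin n → Functions K w)
    (hf : ∀ i, f i ∈ homogeneous K w (d i)) :
    bracket Γ n f = (n.choose 2 : ℤ).negOnePow • ∑ a : Fin n → ι,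
      (∑ k : Fin n, w (a k) * ((∑ i with i < k, d i) + (k : ℕ))).negOnePow •
        prodHom n (component n a Γ) fun i => derivLeft (a i) (f i) := by
  have key : ∀ (u : Fin n → ℤ) (c : Functions K w) (g : Fin n → Functions K w),
      prodHom n c (fun i => (u i).negOnePow • g i) =
        (∑ i, u i).negOnePow • prodHom n c g := by
    intro u c g
    have hs : ∀ (z : ℤ) (x : Functions K w),
        z.negOnePow • x = (((z.negOnePow : ℤˣ) : ℤ) : K) • x := fun z x => by
      rw [Units.smul_def, Int.cast_smul_eq_zsmul]
    simp only [hs]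
    rw [MultilinearMap.map_smul_univ]
    congr 1
    rw [← Int.cast_prod, ← Units.coe_prod]
    congr 2
    have : ∀ t : Finset (Fin n), ∏ i ∈ t, (u i).negOnePow = (∑ i ∈ t, u i).negOnePow := by
      intro t
      induction t using Finset.induction_on with
      | empty => simp
      | insert i t hi ih => rw [prod_insert hi, sum_insert hi, ih, Int.negOnePow_add]
    exact this univ
  simp only [bracket, _root_.sum_apply, _root_.smul_apply,
    MultilinearMap.compLinearMap_apply, LinearMap.comp_apply, smul_sum]
  refine sum_congr rfl fun a _ => ?_
  have h : (fun i => derivLeft (a i) (twist (∑ k with i < k, w (a k)) (f i))) =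
      fun i => ((∑ k with i < k, w (a k)) * d i).negOnePow • derivLeft (a i) (f i) := by
    funext i
    rw [twist_of_mem (hf i), Units.smul_def, Units.smul_def, map_zsmul]
  rw [h, key, smul_smul, smul_smul, ← Int.negOnePow_add, ← Int.negOnePow_add]
  congr 2
  have hswap : ∑ i, (∑ k with i < k, w (a k)) * d i =
      ∑ k, w (a k) * ∑ i with i < k, d i := by
    simp only [Finset.sum_mul, Finset.mul_sum, Finset.sum_filter, ite_mul, mul_ite, zero_mul,
      mul_zero]
    exact Finset.sum_comm
  rw [hswap]
  simp only [mul_add, Finset.sum_add_distrib]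
  ring

/-- The graded Leibniz property in each argument of an `n`-ary bracket `l` of degree `c`:
`l(…,gh,…) = (-1)^(|g|(c + ∑_{i<j}|f_i|)) g l(…,h,…) + (-1)^(|h| ∑_{i>j}|f_i|) l(…,g,…) h`,
the product standing in the `j`-th place. -/
def IsGradedLeibniz (c : ℤ) {n : ℕ}
    (l : MultilinearMap K (fun _ : Fin n => Functions K w) (Functions K w)) : Prop :=
  ∀ (j : Fin n) (d : Fin n → ℤ) (f : Fin n → Functions K w),
    (∀ i, f i ∈ homogeneous K w (d i)) → ∀ (p q : ℤ) (g h : Functions K w),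
    g ∈ homogeneous K w p → h ∈ homogeneous K w q →
      l (Function.update f j (g * h)) =
        (p * (c + ∑ i with i < j, d i)).negOnePow • (g * l (Function.update f j h)) +
        (q * ∑ i with j < i, d i).negOnePow • (l (Function.update f j g) * h)

/-- The graded Leibniz property in each argument with both factors extracted to the right, which
makes sense for brackets that are not homogeneous:
`l(…,gh,…) = (-1)^(|g|(|h| + ∑_{i>j}|f_i|)) l(…,h,…) g + (-1)^(|h| ∑_{i>j}|f_i|) l(…,g,…) h`. -/
def IsGradedLeibnizRight {n : ℕ}
    (l : MultilinearMap K (fun _ : Fin n => Functions K w) (Functions K w)) : Prop :=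
  ∀ (j : Fin n) (d : Fin n → ℤ) (f : Fin n → Functions K w),
    (∀ i, f i ∈ homogeneous K w (d i)) → ∀ (p q : ℤ) (g h : Functions K w),
    g ∈ homogeneous K w p → h ∈ homogeneous K w q →
      l (Function.update f j (g * h)) =
        (p * (q + ∑ i with j < i, d i)).negOnePow • (l (Function.update f j h) * g) +
        (q * ∑ i with j < i, d i).negOnePow • (l (Function.update f j g) * h)

end Manifold

end FormalGraded

end

/-!
The brackets `L_n` are derived brackets. A function `g`, regarded as a polyvector field of weight
zero by `incl`, acts on polyvector fields by `A ↦ A • g = ∑ ∂A/∂ψ_a ∂g/∂t^a`, and everything rests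
on the recursion (`bracket_succ`)

  `L_{n+1}^Γ(f_1, …, f_n, g) = ± L_n^{Γ • g}(f_1, …, f_n)`,  `L_0^Γ = Γ|_{ψ = 0}`,

valid for every polyvector field `Γ`, homogeneous or not. It reduces each assertion about brackets
to an assertion about the operators `• g`.

* These operators commute up to sign (`bullet_incl_comm`), so that an argument at an arbitrary place
  can be split off (`bracket_succAbove`); a permutation of `n + 1` elements is a permutation of `n`
  elements with the largest element inserted at some place (`insertPerm`), whence graded
  skew-symmetry by induction (`bracket_perm`).
* `A • g` is a derivation in `g` (`bullet_incl_mul`), and multiplication by a function commutes up to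
  sign with the operators `• g` (`bullet_mul_incl`), whence the Leibniz rule. Its form with one factor
  on the left follows by graded commutativity, as `L_n` has a degree when `Γ` does.
* `• g` is not a derivation of the product `•` of polyvector fields: the second derivatives of `g`
  enter (`hessian`). Their contribution is graded symmetric and cancels in the Schouten bracket, so
  that `• g` is a graded derivation of `[ , ]_S` (`bullet_schouten_incl`).

For the `L_∞` relations, consider more generally the Jacobi expression `J_n(A, B)` with the outer
bracket taken from `A` and the inner one from `B`. In an unshuffle the last argument `g` is the last
one of the outer or of the inner bracket, so the recursion gives
`J_{n+1}(A, B; …, g) = ± J_n(A • g, B) ± J_n(A, B • g)` (`jacobiSum_succ`). As `• g` is a derivation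
of the Schouten bracket, induction on `n` identifies `± J_n(A, B) ± J_n(B, A)` with minus the bracket
defined by `[A, B]_S` (`jacobiSum_add_jacobiSum`). For `A = B = Γ` of degree `2` the Jacobi relations
say that all brackets of `[Γ, Γ]_S` vanish. Finally, since `Γ • t^a = ∂Γ/∂ψ_a`, in characteristic zero
the brackets of coordinate functions detect all coefficients of a polyvector field
(`coeff_eq_zero_of_bracket_var`): they show that `Γ` has degree `2` if each `L_n` has degree `2 - n`,
and that `[Γ, Γ]_S = 0` if all its brackets vanish.
-/

set_option linter.unusedSectionVars false
set_option linter.unnecessarySeqFocus false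

noncomputable section

namespace FormalGraded

/-! ### Signs -/

/-- A sign `(-1)^z` only depends on `z` modulo `2`. Identities between signs are reduced by this to
polynomial identities over `ZMod 2`. -/
theorem negOnePow_congr {a b : ℤ} (h : (a : ZMod 2) = b) : a.negOnePow = b.negOnePow := by
  rw [Int.negOnePow_eq_iff, ← ZMod.intCast_eq_zero_iff_even]
  push_cast
  rw [h, sub_self]

theorem zmod_two_mul_self (x : ZMod 2) : x * x = x := by
  revert x
  decide

theorem prod_negOnePow {α : Type*} (s : Finset α) (u : α → ℤ) :
    ∏ i ∈ s, (u i).negOnePow = (∑ i ∈ s, u i).negOnePow := by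
  classical
  induction s using Finset.induction_on with
  | empty => simp
  | insert i t hi ih => rw [prod_insert hi, sum_insert hi, ih, Int.negOnePow_add]

section Series

variable {J : Type*} [LinearOrder J] {K : Type*} [Field K] {w : J → ℤ}

/-! ### Degrees of monomials and exponents of signs -/

theorem IsAdmissible.of_add_left {m n : J →₀ ℕ} (h : IsAdmissible w (m + n)) :
    IsAdmissible w m := fun a ha =>
  (Nat.le_add_right _ _).trans (by simpa using h a ha)

theorem IsAdmissible.of_add_right {m n : J →₀ ℕ} (h : IsAdmissible w (m + n)) :
    IsAdmissible w n := fun a ha =>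
  (Nat.le_add_left _ _).trans (by simpa using h a ha)

theorem isAdmissible_zero : IsAdmissible w 0 := fun a _ => by simp

/-- The degree of the part of the monomial `x^m` in the variables before `x_a`. -/
def degreeBelow (w : J → ℤ) (a : J) (m : J →₀ ℕ) : ℤ :=
  m.sum fun b k => if b < a then (k : ℤ) * w b else 0

/-- The degree of the part of the monomial `x^m` in the variables after `x_a`. -/
def degreeAbove (w : J → ℤ) (a : J) (m : J →₀ ℕ) : ℤ :=
  m.sum fun b k => if a < b then (k : ℤ) * w b else 0

/-- The exponent of the sign `mulSign`. -/
def mulExponent (w : J → ℤ) (m n : J →₀ ℕ) : ℤ :=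
  m.sum fun a k => n.sum fun b l => if b < a then ((k : ℤ) * w a) * ((l : ℤ) * w b) else 0

theorem degreeBelow_add (a : J) (m n : J →₀ ℕ) :
    degreeBelow w a (m + n) = degreeBelow w a m + degreeBelow w a n :=
  Finsupp.sum_add_index' (by simp) fun b k l => by split_ifs <;> push_cast <;> ring

theorem monomialDegree_add (m n : J →₀ ℕ) :
    monomialDegree w (m + n) = monomialDegree w m + monomialDegree w n :=
  Finsupp.sum_add_index' (by simp) fun b k l => by push_cast; ring

theorem mulExponent_add_left (m m' n : J →₀ ℕ) :
    mulExponent w (m + m') n = mulExponent w m n + mulExponent w m' n :=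
  Finsupp.sum_add_index' (by simp) fun b k l => by
    rw [← Finsupp.sum_add]
    refine Finsupp.sum_congr fun c _ => ?_
    split_ifs <;> push_cast <;> ring

theorem mulExponent_add_right (m n n' : J →₀ ℕ) :
    mulExponent w m (n + n') = mulExponent w m n + mulExponent w m n' := by
  rw [mulExponent, mulExponent, mulExponent, ← Finsupp.sum_add]
  refine Finsupp.sum_congr fun c _ => ?_
  exact Finsupp.sum_add_index' (by simp) fun b k l => by split_ifs <;> push_cast <;> ring

theorem mulExponent_single_left (a : J) (n : J →₀ ℕ) :
    mulExponent w (Finsupp.single a 1) n = w a * degreeBelow w a n := by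
  rw [mulExponent, Finsupp.sum_single_index (by simp), degreeBelow, Finsupp.mul_sum]
  refine Finsupp.sum_congr fun c _ => ?_
  split_ifs <;> simp

theorem mulExponent_single_right (a : J) (m : J →₀ ℕ) :
    mulExponent w m (Finsupp.single a 1) = w a * degreeAbove w a m := by
  rw [mulExponent, degreeAbove, Finsupp.mul_sum]
  refine Finsupp.sum_congr fun c _ => ?_
  rw [Finsupp.sum_single_index (by simp)]
  split_ifs <;> simp [mul_comm]

theorem degreeBelow_single (a b : J) :
    degreeBelow w a (Finsupp.single b 1) = if b < a then w b else 0 := by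
  rw [degreeBelow, Finsupp.sum_single_index (by simp)]
  simp

theorem monomialDegree_single (a : J) : monomialDegree w (Finsupp.single a 1) = w a := by
  rw [monomialDegree, Finsupp.sum_single_index (by simp)]
  simp

theorem monomialDegree_eq (a : J) (m : J →₀ ℕ) :
    monomialDegree w m = degreeBelow w a m + m a * w a + degreeAbove w a m := by
  have h : (m a : ℤ) * w a = m.sum fun b k => if b = a then (k : ℤ) * w b else 0 := by
    rw [Finsupp.sum, Finset.sum_ite_eq']
    split_ifs with h
    · rfl
    · rw [Finsupp.notMem_support_iff.1 h]; simp
  rw [h, degreeBelow, degreeAbove, monomialDegree, ← Finsupp.sum_add, ← Finsupp.sum_add]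
  refine Finsupp.sum_congr fun c _ => ?_
  rcases lt_trichotomy c a with h | h | h
  · simp [h, h.ne, h.not_gt]
  · simp [h]
  · simp [h, h.ne', h.not_gt]

/-- Monomials commute up to the sign `(-1)^(|x^m||x^n|)`, up to the contribution of pairs of equal
variables. -/
theorem mulExponent_add_swap (m n : J →₀ ℕ) :
    mulExponent w m n + mulExponent w n m + m.sum (fun a k => (k * w a) * (n a * w a)) =
      monomialDegree w m * monomialDegree w n := by
  have h1 : mulExponent w n m = m.sum fun a k => n.sum fun b l =>
      if a < b then ((k : ℤ) * w a) * ((l : ℤ) * w b) else 0 := by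
    rw [mulExponent, Finsupp.sum_comm]
    refine Finsupp.sum_congr fun a _ => Finsupp.sum_congr fun b _ => ?_
    rw [mul_comm]
  rw [h1, mulExponent, ← Finsupp.sum_add, ← Finsupp.sum_add]
  conv_rhs => rw [monomialDegree, Finsupp.sum_mul]
  refine Finsupp.sum_congr fun a _ => ?_
  rw [monomialDegree_eq a n, degreeBelow, degreeAbove, mul_add, mul_add, Finsupp.mul_sum,
    Finsupp.mul_sum]
  simp only [mul_ite, mul_zero]
  ring

/-- In an admissible product no odd variable occurs in both factors. -/
theorem even_diagonal {m n : J →₀ ℕ} (h : IsAdmissible w (m + n)) :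
    ((m.sum fun a k => ((k : ℤ) * w a) * (n a * w a) : ℤ) : ZMod 2) = 0 := by
  rw [Finsupp.sum, Int.cast_sum]
  refine Finset.sum_eq_zero fun a _ => ?_
  rcases Int.even_or_odd (w a) with ha | ha
  · have : (w a : ZMod 2) = 0 := ZMod.intCast_eq_zero_iff_even.2 ha
    simp [this]
  · have h2 := h a ha
    simp only [Finsupp.coe_add, Pi.add_apply] at h2
    have : m a = 0 ∨ n a = 0 := by omega
    rcases this with h | h <;> simp [h]

end Series

namespace SuperSeries

variable {J : Type*} [LinearOrder J] {K : Type*} [Field K] {w : J → ℤ}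

/-! ### The ring of graded-commutative power series -/

theorem coeff_apply {m : J →₀ ℕ} (h : IsAdmissible w m) (f : SuperSeries K w) :
    coeff m f = f ⟨m, h⟩ := dif_pos h

theorem coeff_eq_zero {m : J →₀ ℕ} (h : ¬ IsAdmissible w m) (f : SuperSeries K w) :
    coeff m f = 0 := dif_neg h

@[ext]
theorem ext {f g : SuperSeries K w}
    (h : ∀ m, IsAdmissible w m → coeff m f = coeff m g) : f = g :=
  funext fun m => by
    have := h m.1 m.2
    rwa [coeff_apply m.2, coeff_apply m.2] at this

theorem coeff_ofCoeffs {M : Type*} [AddCommGroup M] [Module K M] (c : (J →₀ ℕ) → M →ₗ[K] K)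
    {m : J →₀ ℕ} (h : IsAdmissible w m) (x : M) :
    coeff m (ofCoeffs (w := w) c x) = c m x := coeff_apply h _

theorem coeff_mul {m : J →₀ ℕ} (h : IsAdmissible w m) (f g : SuperSeries K w) :
    coeff m (f * g) = ∑ p ∈ antidiagonal m,
      (mulExponent w p.1 p.2).negOnePow • (coeff p.1 f * coeff p.2 g) := coeff_apply h _

theorem coeff_twist (c : ℤ) {m : J →₀ ℕ} (h : IsAdmissible w m) (f : SuperSeries K w) :
    coeff m (twist c f) = (c * monomialDegree w m).negOnePow • coeff m f := coeff_apply h _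

theorem coeff_derivLeft (a : J) {m : J →₀ ℕ} (h : IsAdmissible w m) (f : SuperSeries K w) :
    coeff m (derivLeft a f) = (w a * degreeBelow w a m).negOnePow •
      ((m a + 1 : K) * coeff (m + Finsupp.single a 1) f) := coeff_apply h _

theorem coeff_derivRight (a : J) {m : J →₀ ℕ} (h : IsAdmissible w m) (f : SuperSeries K w) :
    coeff m (derivRight a f) = (w a * degreeAbove w a m).negOnePow •
      ((m a + 1 : K) * coeff (m + Finsupp.single a 1) f) := coeff_apply h _

theorem coeff_unit_smul (z : ℤˣ) (m : J →₀ ℕ) (f : SuperSeries K w) :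
    coeff m (z • f) = z • coeff m f := by
  rw [Units.smul_def, Units.smul_def, map_zsmul]

theorem map_unit_smul {M N : Type*} [AddCommGroup M] [AddCommGroup N] [Module K M] [Module K N]
    (φ : M →ₗ[K] N) (z : ℤˣ) (x : M) : φ (z • x) = z • φ x := by
  rw [Units.smul_def, Units.smul_def, map_zsmul]

/-- The constant series `1`. -/
instance : One (SuperSeries K w) := ⟨fun m => if m.1 = 0 then 1 else 0⟩

theorem coeff_one {m : J →₀ ℕ} (h : IsAdmissible w m) :
    coeff m (1 : SuperSeries K w) = if m = 0 then 1 else 0 := coeff_apply h _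

theorem mul_def (f g : SuperSeries K w) : f * g = mulHom f g := rfl

instance : Ring (SuperSeries K w) where
  __ := (inferInstance : AddCommGroup (SuperSeries K w))
  left_distrib f g h := map_add (mulHom f) g h
  right_distrib f g h := by simp only [mul_def, map_add, LinearMap.add_apply]
  zero_mul f := by simp only [mul_def, map_zero, LinearMap.zero_apply]
  mul_zero f := map_zero (mulHom f)
  mul_assoc f g h := by
    ext m hm
    rw [coeff_mul hm, coeff_mul hm]
    have h1 : ∀ p ∈ antidiagonal m, (mulExponent w p.1 p.2).negOnePow •
        (coeff p.1 (f * g) * coeff p.2 h) = ∑ q ∈ antidiagonal p.1,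
          (mulExponent w q.1 q.2 + mulExponent w q.1 p.2 + mulExponent w q.2 p.2).negOnePow •
            (coeff q.1 f * coeff q.2 g * coeff p.2 h) := fun p hp => by
      rw [HasAntidiagonal.mem_antidiagonal] at hp
      subst hp
      rw [coeff_mul hm.of_add_left, sum_mul, smul_sum]
      refine sum_congr rfl fun q hq => ?_
      rw [HasAntidiagonal.mem_antidiagonal] at hq
      rw [← hq, smul_mul_assoc, smul_smul, ← Int.negOnePow_add, mulExponent_add_left]
      congr 2
      ring
    have h2 : ∀ p ∈ antidiagonal m, (mulExponent w p.1 p.2).negOnePow •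
        (coeff p.1 f * coeff p.2 (g * h)) = ∑ q ∈ antidiagonal p.2,
          (mulExponent w p.1 q.1 + mulExponent w p.1 q.2 + mulExponent w q.1 q.2).negOnePow •
            (coeff p.1 f * coeff q.1 g * coeff q.2 h) := fun p hp => by
      rw [HasAntidiagonal.mem_antidiagonal] at hp
      subst hp
      rw [coeff_mul hm.of_add_right, mul_sum, smul_sum]
      refine sum_congr rfl fun q hq => ?_
      rw [HasAntidiagonal.mem_antidiagonal] at hq
      rw [← hq, mul_smul_comm, smul_smul, ← Int.negOnePow_add, mulExponent_add_right, mul_assoc]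
    rw [sum_congr rfl h1, sum_congr rfl h2, sum_sigma', sum_sigma']
    refine Finset.sum_nbij' (fun x => ⟨(x.2.1, x.2.2 + x.1.2), (x.2.2, x.1.2)⟩)
      (fun x => ⟨(x.1.1 + x.2.1, x.2.2), (x.1.1, x.2.1)⟩) ?_ ?_ ?_ ?_ ?_
    · rintro ⟨⟨a, b⟩, ⟨c, d⟩⟩ h
      simp only [mem_sigma, HasAntidiagonal.mem_antidiagonal] at h ⊢
      rw [← h.1, ← h.2, add_assoc]
      simp
    · rintro ⟨⟨a, b⟩, ⟨c, d⟩⟩ h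
      simp only [mem_sigma, HasAntidiagonal.mem_antidiagonal] at h ⊢
      rw [← h.1, ← h.2, add_assoc]
      simp
    · rintro ⟨⟨a, b⟩, ⟨c, d⟩⟩ h
      simp only [mem_sigma, HasAntidiagonal.mem_antidiagonal] at h
      rw [← h.2]
    · rintro ⟨⟨a, b⟩, ⟨c, d⟩⟩ h
      simp only [mem_sigma, HasAntidiagonal.mem_antidiagonal] at h
      rw [← h.2]
    · rintro ⟨⟨a, b⟩, ⟨c, d⟩⟩ h
      rfl
  one_mul f := by
    ext m hm
    rw [coeff_mul hm, sum_eq_single (0, m)]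
    · simp [coeff_one isAdmissible_zero, mulExponent]
    · rintro ⟨p, q⟩ hp hne
      rw [HasAntidiagonal.mem_antidiagonal] at hp
      dsimp only at hp ⊢
      subst hp
      rw [coeff_one hm.of_add_left, if_neg, zero_mul, smul_zero]
      rintro rfl
      simp at hne
    · simp
  mul_one f := by
    ext m hm
    rw [coeff_mul hm, sum_eq_single (m, 0)]
    · simp [coeff_one isAdmissible_zero, mulExponent]
    · rintro ⟨p, q⟩ hp hne
      rw [HasAntidiagonal.mem_antidiagonal] at hp
      dsimp only at hp ⊢
      subst hp
      rw [coeff_one hm.of_add_right, if_neg, mul_zero, smul_zero]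
      rintro rfl
      simp at hne
    · simp

instance : IsScalarTower K (SuperSeries K w) (SuperSeries K w) :=
  ⟨fun c f g => by simp only [smul_eq_mul, mul_def, map_smul, LinearMap.smul_apply]⟩

instance : SMulCommClass K (SuperSeries K w) (SuperSeries K w) :=
  ⟨fun c f g => by simp only [smul_eq_mul, mul_def, map_smul]⟩

/-! ### Homogeneous series -/

theorem mul_mem_homogeneous {p q : ℤ} {f g : SuperSeries K w} (hf : f ∈ homogeneous K w p)
    (hg : g ∈ homogeneous K w q) : f * g ∈ homogeneous K w (p + q) := by
  intro m hm
  by_cases h : IsAdmissible w m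
  · rw [coeff_mul h]
    refine sum_eq_zero fun x hx => ?_
    rw [HasAntidiagonal.mem_antidiagonal] at hx
    by_cases h1 : monomialDegree w x.1 = p
    · rw [hg x.2, mul_zero, smul_zero]
      rintro rfl
      rw [← hx, monomialDegree_add, h1] at hm
      exact hm rfl
    · rw [hf _ h1, zero_mul, smul_zero]
  · exact coeff_eq_zero h _

theorem unit_smul_mem_homogeneous {p : ℤ} {f : SuperSeries K w} (z : ℤˣ)
    (hf : f ∈ homogeneous K w p) : z • f ∈ homogeneous K w p := by
  rw [Units.smul_def]
  exact zsmul_mem hf _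

theorem one_mem_homogeneous : (1 : SuperSeries K w) ∈ homogeneous K w 0 := by
  intro m hm
  by_cases h : IsAdmissible w m
  · rw [coeff_one h, if_neg]
    rintro rfl
    exact hm rfl
  · exact coeff_eq_zero h _

theorem derivLeft_mem_homogeneous {p : ℤ} {f : SuperSeries K w} (hf : f ∈ homogeneous K w p)
    (a : J) : derivLeft a f ∈ homogeneous K w (p - w a) := by
  intro m hm
  by_cases h : IsAdmissible w m
  · rw [coeff_derivLeft a h, hf, mul_zero, smul_zero]
    rw [monomialDegree_add, monomialDegree_single]
    intro h
    exact hm (by omega)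
  · exact coeff_eq_zero h _

theorem twist_eq {d : ℤ} {f : SuperSeries K w} (hf : f ∈ homogeneous K w d) (c : ℤ) :
    twist c f = (c * d).negOnePow • f := by
  ext m hm
  rw [coeff_twist c hm, coeff_unit_smul]
  by_cases h : monomialDegree w m = d
  · rw [h]
  · rw [hf m h, smul_zero, smul_zero]

theorem twist_mem_homogeneous {d : ℤ} {f : SuperSeries K w} (hf : f ∈ homogeneous K w d) (c : ℤ) :
    twist c f ∈ homogeneous K w d := by
  rw [twist_eq hf]
  exact unit_smul_mem_homogeneous _ hf

/-- The right derivative is a left derivative followed by a twist: the removed variable passes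
the remaining ones. -/
theorem derivRight_eq (a : J) (f : SuperSeries K w) :
    derivRight a f = twist (w a) (derivLeft a f) := by
  ext m hm
  rw [coeff_derivRight a hm, coeff_twist _ hm, coeff_derivLeft a hm, smul_smul,
    ← Int.negOnePow_add]
  by_cases h : IsAdmissible w (m + Finsupp.single a 1)
  · -- The exponents differ by `(m a) |x_a|²`, and `m a = 0` if `x_a` is odd.
    congr 1
    apply negOnePow_congr
    rw [monomialDegree_eq a m]
    rcases Int.even_or_odd (w a) with ha | ha
    · have : (w a : ZMod 2) = 0 := ZMod.intCast_eq_zero_iff_even.2 ha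
      simp [this]
    · have := h a ha
      have : m a = 0 := by simpa using this
      rw [this]
      push_cast
      grind
  · rw [coeff_eq_zero h, mul_zero, smul_zero, smul_zero]

theorem derivRight_mem_homogeneous {p : ℤ} {f : SuperSeries K w} (hf : f ∈ homogeneous K w p)
    (a : J) : derivRight a f ∈ homogeneous K w (p - w a) := by
  rw [derivRight_eq]
  exact twist_mem_homogeneous (derivLeft_mem_homogeneous hf a) _

/-- Graded commutativity. -/
theorem mul_comm_of_mem {p q : ℤ} {f g : SuperSeries K w} (hf : f ∈ homogeneous K w p)
    (hg : g ∈ homogeneous K w q) : f * g = (p * q).negOnePow • (g * f) := by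
  ext m hm
  rw [coeff_unit_smul, coeff_mul hm, coeff_mul hm, smul_sum]
  refine Finset.sum_nbij' Prod.swap Prod.swap (by simp [add_comm]) (by simp [add_comm]) (by simp)
    (by simp) fun x hx => ?_
  rw [HasAntidiagonal.mem_antidiagonal] at hx
  subst hx
  rw [Prod.fst_swap, Prod.snd_swap, mul_comm (coeff x.2 g), smul_smul, ← Int.negOnePow_add]
  by_cases h1 : monomialDegree w x.1 = p
  · by_cases h2 : monomialDegree w x.2 = q
    · congr 1
      apply negOnePow_congr
      have h := congrArg (Int.cast : ℤ → ZMod 2) (mulExponent_add_swap (w := w) x.1 x.2)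
      rw [Int.cast_add, even_diagonal hm, h1, h2] at h
      push_cast at h ⊢
      grind
    · rw [hg _ h2, mul_zero, smul_zero, smul_zero]
  · rw [hf _ h1, zero_mul, smul_zero, smul_zero]

theorem twist_mul (c : ℤ) (f g : SuperSeries K w) : twist c (f * g) = twist c f * twist c g := by
  ext m hm
  rw [coeff_twist c hm, coeff_mul hm, coeff_mul hm, smul_sum]
  refine sum_congr rfl fun x hx => ?_
  rw [HasAntidiagonal.mem_antidiagonal] at hx
  subst hx
  rw [coeff_twist c hm.of_add_left, coeff_twist c hm.of_add_right, smul_mul_smul_comm, smul_smul,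
    smul_smul, monomialDegree_add, mul_add, Int.negOnePow_add, mul_comm]

theorem twist_twist (c : ℤ) (f : SuperSeries K w) : twist c (twist c f) = f := by
  ext m hm
  rw [coeff_twist c hm, coeff_twist c hm, smul_smul, Int.units_mul_self, one_smul]

/-! ### Derivations -/

/-- The factorizations of `x^m x_a` whose first factor contains `x_a` are those of `x^m`. -/
theorem sum_antidiagonal_add_single {M : Type*} [AddCommMonoid M] (a : J) (m : J →₀ ℕ)
    (F : (J →₀ ℕ) → (J →₀ ℕ) → M) (hF : ∀ p q, p a = 0 → F p q = 0) :
    ∑ x ∈ antidiagonal m, F (x.1 + Finsupp.single a 1) x.2 =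
      ∑ x ∈ antidiagonal (m + Finsupp.single a 1), F x.1 x.2 := by
  refine Finset.sum_of_injOn (fun x => (x.1 + Finsupp.single a 1, x.2)) ?_ ?_ ?_
    fun _ _ => rfl
  · rintro ⟨p, q⟩ _ ⟨p', q'⟩ _ h
    simpa using h
  · rintro ⟨p, q⟩ h
    simp only [mem_coe, HasAntidiagonal.mem_antidiagonal] at h ⊢
    rw [← h, add_right_comm]
  · rintro ⟨p, q⟩ h hn
    rw [HasAntidiagonal.mem_antidiagonal] at h
    refine hF p q ?_
    by_contra hp
    refine hn ⟨(p - Finsupp.single a 1, q), ?_, ?_⟩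
    · have hle : Finsupp.single a 1 ≤ p := by
        rw [Finsupp.single_le_iff]; omega
      simp only [mem_coe, HasAntidiagonal.mem_antidiagonal] at h ⊢
      apply add_right_cancel (b := Finsupp.single a 1)
      rw [← h, add_right_comm, tsub_add_cancel_of_le hle]
    · have hle : Finsupp.single a 1 ≤ p := by
        rw [Finsupp.single_le_iff]; omega
      simp only
      rw [tsub_add_cancel_of_le hle]

theorem sum_antidiagonal_add_single_right {M : Type*} [AddCommMonoid M] (a : J) (m : J →₀ ℕ)
    (F : (J →₀ ℕ) → (J →₀ ℕ) → M) (hF : ∀ p q, q a = 0 → F p q = 0) :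
    ∑ x ∈ antidiagonal m, F x.1 (x.2 + Finsupp.single a 1) =
      ∑ x ∈ antidiagonal (m + Finsupp.single a 1), F x.1 x.2 := by
  have h : ∀ n : J →₀ ℕ, ∀ G : (J →₀ ℕ) → (J →₀ ℕ) → M,
      ∑ x ∈ antidiagonal n, G x.1 x.2 = ∑ x ∈ antidiagonal n, G x.2 x.1 := fun n G =>
    Finset.sum_nbij' Prod.swap Prod.swap (by simp [add_comm]) (by simp [add_comm]) (by simp)
      (by simp) fun x hx => rfl
  rw [h m fun p q => F p (q + Finsupp.single a 1), h _ F]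
  exact sum_antidiagonal_add_single a m (fun p q => F q p) fun p q => hF q p

/-- The graded Leibniz rule for left derivatives. -/
theorem derivLeft_mul (a : J) (f g : SuperSeries K w) :
    derivLeft a (f * g) = derivLeft a f * g + twist (w a) f * derivLeft a g := by
  ext m hm
  -- Both summands on the right are sums over the splittings of `x^m x_a`.
  have e1 : coeff m (derivLeft a f * g) = ∑ x ∈ antidiagonal (m + Finsupp.single a 1),
      (w a * degreeBelow w a m + mulExponent w x.1 x.2).negOnePow •
        ((x.1 a : K) * (coeff x.1 f * coeff x.2 g)) := by
    rw [coeff_mul hm, ← sum_antidiagonal_add_single a m (fun p q =>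
      (w a * degreeBelow w a m + mulExponent w p q).negOnePow •
        ((p a : K) * (coeff p f * coeff q g))) (fun p q h => by simp [h])]
    refine sum_congr rfl fun x hx => ?_
    rw [HasAntidiagonal.mem_antidiagonal] at hx
    subst hx
    rw [coeff_derivLeft a hm.of_add_left, smul_mul_assoc, smul_smul, ← Int.negOnePow_add,
      mulExponent_add_left, mulExponent_single_left, degreeBelow_add, mul_assoc]
    congr 1
    · apply negOnePow_congr
      push_cast
      grind
    · simp
  have e2 : coeff m (twist (w a) f * derivLeft a g) =
      ∑ x ∈ antidiagonal (m + Finsupp.single a 1),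
      (w a * degreeBelow w a m + mulExponent w x.1 x.2).negOnePow •
        ((w a * (x.1 a * w a)).negOnePow •
          ((x.2 a : K) * (coeff x.1 f * coeff x.2 g))) := by
    rw [coeff_mul hm, ← sum_antidiagonal_add_single_right a m (fun p q =>
      (w a * degreeBelow w a m + mulExponent w p q).negOnePow •
        ((w a * (p a * w a)).negOnePow • ((q a : K) * (coeff p f * coeff q g))))
      (fun p q h => by simp [h])]
    refine sum_congr rfl fun x hx => ?_
    rw [HasAntidiagonal.mem_antidiagonal] at hx
    subst hx
    rw [coeff_derivLeft a hm.of_add_right, coeff_twist _ hm.of_add_left, smul_mul_smul_comm,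
      smul_smul, ← Int.negOnePow_add, ← Int.negOnePow_add, smul_smul, ← Int.negOnePow_add,
      mulExponent_add_right, mulExponent_single_right, degreeBelow_add, monomialDegree_eq a,
      mul_left_comm]
    congr 1
    · apply negOnePow_congr
      push_cast
      grind
    · simp
  rw [map_add, e1, e2, ← sum_add_distrib, coeff_derivLeft a hm]
  by_cases h : IsAdmissible w (m + Finsupp.single a 1)
  · rw [coeff_mul h, mul_sum, smul_sum]
    refine sum_congr rfl fun x hx => ?_
    rw [HasAntidiagonal.mem_antidiagonal] at hx
    have hxa : m a + 1 = x.1 a + x.2 a := by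
      have := DFunLike.congr_fun hx a
      simpa using this.symm
    have hxK : (m a + 1 : K) = x.1 a + x.2 a := by exact_mod_cast congrArg (Nat.cast : ℕ → K) hxa
    rw [← smul_add, Int.negOnePow_add, mul_smul, mul_smul_comm, hxK, add_mul]
    congr 4
    rcases Int.even_or_odd (w a) with ha | ha
    · rw [Int.negOnePow_even _ (ha.mul_right _), one_smul]
    · have := h a ha
      simp only [Finsupp.coe_add, Pi.add_apply, Finsupp.single_eq_same] at this
      have : x.1 a = 0 ∨ x.2 a = 0 := by omega
      rcases this with h | h <;> simp [h]
  · -- The square of the odd variable `x_a` vanishes, and the two summands cancel.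
    rw [coeff_eq_zero h, mul_zero, smul_zero, eq_comm]
    refine sum_eq_zero fun x hx => ?_
    rw [HasAntidiagonal.mem_antidiagonal] at hx
    have hxa : m a + 1 = x.1 a + x.2 a := by
      have := DFunLike.congr_fun hx a
      simpa using this.symm
    by_cases h1 : IsAdmissible w x.1
    · by_cases h2 : IsAdmissible w x.2
      · have : ∃ b, Odd (w b) ∧ 1 < (m + Finsupp.single a 1 : J →₀ ℕ) b := by
          simpa [IsAdmissible] using h
        obtain ⟨b, hb, hb1⟩ := this
        have hba : b = a := by
          by_contra hne
          have := hm b hb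
          simp [Ne.symm hne] at hb1
          omega
        subst hba
        have h1b := h1 b hb
        have h2b := h2 b hb
        have hmb := hm b hb
        simp at hb1
        have p1 : x.1 b = 1 := by omega
        have p2 : x.2 b = 1 := by omega
        rw [p1, p2, ← smul_add, Nat.cast_one, Nat.cast_one, Int.negOnePow_odd (w b * (1 * w b))
          (by rw [one_mul]; exact hb.mul hb)]
        simp
      · simp [coeff_eq_zero h2]
    · simp [coeff_eq_zero h1]

theorem derivLeft_comm (a b : J) (f : SuperSeries K w) :
    derivLeft a (derivLeft b f) = (w a * w b).negOnePow • derivLeft b (derivLeft a f) := by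
  ext m hm
  rw [coeff_unit_smul, coeff_derivLeft a hm, coeff_derivLeft b hm]
  by_cases h : IsAdmissible w (m + Finsupp.single a 1 + Finsupp.single b 1)
  · have h' : IsAdmissible w (m + Finsupp.single b 1 + Finsupp.single a 1) := by
      rwa [add_right_comm]
    rw [coeff_derivLeft b h.of_add_left, coeff_derivLeft a h'.of_add_left]
    rcases eq_or_ne a b with rfl | hab
    · suffices hw : Even (w a * w a) by rw [Int.negOnePow_even _ hw, one_smul]
      by_contra hw
      rw [Int.not_even_iff_odd, Int.odd_mul] at hw
      have := h a hw.1
      simp at this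
    · rw [mul_smul_comm, mul_smul_comm, smul_smul, smul_smul, smul_smul, ← Int.negOnePow_add,
        ← Int.negOnePow_add, ← Int.negOnePow_add, add_right_comm m, degreeBelow_add,
        degreeBelow_add, degreeBelow_single, degreeBelow_single]
      congr 1
      · apply negOnePow_congr
        rcases lt_or_gt_of_ne hab with h | h
        · simp only [h, h.not_gt, if_true, if_false]
          push_cast
          grind
        · simp only [h, h.not_gt, if_true, if_false]
          push_cast
          grind
      · simp [hab, hab.symm]
        ring
  · have h' : ¬ IsAdmissible w (m + Finsupp.single b 1 + Finsupp.single a 1) := by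
      rwa [add_right_comm]
    have e : ∀ {c d : J}, ¬ IsAdmissible w (m + Finsupp.single c 1 + Finsupp.single d 1) →
        coeff (m + Finsupp.single c 1) (derivLeft d f) = 0 := fun {c d} h => by
      by_cases hc : IsAdmissible w (m + Finsupp.single c 1)
      · rw [coeff_derivLeft _ hc, coeff_eq_zero h, mul_zero, smul_zero]
      · exact coeff_eq_zero hc _
    simp [e h, e h']

theorem twist_comm (c d : ℤ) (f : SuperSeries K w) :
    twist c (twist d f) = twist d (twist c f) := by
  ext m hm
  rw [coeff_twist _ hm, coeff_twist _ hm, coeff_twist _ hm, coeff_twist _ hm, smul_comm]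

theorem derivLeft_twist (a : J) (c : ℤ) (f : SuperSeries K w) :
    derivLeft a (twist c f) = (c * w a).negOnePow • twist c (derivLeft a f) := by
  ext m hm
  rw [coeff_unit_smul, coeff_derivLeft _ hm, coeff_twist _ hm, coeff_derivLeft _ hm]
  by_cases h : IsAdmissible w (m + Finsupp.single a 1)
  · rw [coeff_twist _ h, mul_smul_comm, smul_smul, smul_smul, smul_smul, ← Int.negOnePow_add,
      ← Int.negOnePow_add, ← Int.negOnePow_add, monomialDegree_add, monomialDegree_single]
    congr 2
    ring
  · rw [coeff_eq_zero h, coeff_eq_zero h, mul_zero, smul_zero, smul_zero, smul_zero]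

/-- The graded Leibniz rule for right derivatives. -/
theorem derivRight_mul (a : J) (f g : SuperSeries K w) :
    derivRight a (f * g) = derivRight a f * twist (w a) g + f * derivRight a g := by
  simp only [derivRight_eq, derivLeft_mul, map_add, twist_mul, twist_twist]

theorem derivRight_comm (a b : J) (f : SuperSeries K w) :
    derivRight a (derivRight b f) = (w a * w b).negOnePow • derivRight b (derivRight a f) := by
  simp only [derivRight_eq, derivLeft_twist, map_unit_smul]
  rw [derivLeft_comm, map_unit_smul, map_unit_smul, twist_comm, mul_comm (w b)]

theorem derivRight_derivLeft (a b : J) (f : SuperSeries K w) :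
    derivRight a (derivLeft b f) = derivLeft b (derivRight a f) := by
  simp only [derivRight_eq, derivLeft_twist]
  rw [derivLeft_comm, map_unit_smul]

/-- The variable `x_a`. -/
def var (a : J) : SuperSeries K w := fun m => if m.1 = Finsupp.single a 1 then 1 else 0

theorem isAdmissible_single (a : J) : IsAdmissible w (Finsupp.single a 1) := fun b _ => by
  rw [Finsupp.single_apply]
  split_ifs <;> simp

theorem coeff_var (a : J) {m : J →₀ ℕ} (h : IsAdmissible w m) :
    coeff m (var a : SuperSeries K w) = if m = Finsupp.single a 1 then 1 else 0 :=
  coeff_apply h _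

theorem var_mem_homogeneous (a : J) : (var a : SuperSeries K w) ∈ homogeneous K w (w a) := by
  intro m hm
  by_cases h : IsAdmissible w m
  · rw [coeff_var a h, if_neg]
    rintro rfl
    exact hm (monomialDegree_single a)
  · exact coeff_eq_zero h _

theorem derivLeft_var (a b : J) :
    derivLeft a (var b : SuperSeries K w) = if a = b then 1 else 0 := by
  ext m hm
  have key : coeff (m + Finsupp.single a 1) (var b : SuperSeries K w) =
      if a = b ∧ m = 0 then 1 else 0 := by
    by_cases h : IsAdmissible w (m + Finsupp.single a 1)
    · rw [coeff_var b h]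
      congr 1
      rw [eq_iff_iff]
      constructor
      · intro h
        have h1 := DFunLike.congr_fun h a
        have hab : a = b := by
          by_contra hab
          simp [Ne.symm hab] at h1
        subst hab
        simpa using h
      · rintro ⟨rfl, rfl⟩
        simp
    · rw [coeff_eq_zero h, if_neg]
      rintro ⟨rfl, rfl⟩
      rw [zero_add] at h
      exact h (isAdmissible_single a)
  rw [coeff_derivLeft a hm, key]
  split_ifs with h h1 h1
  · rw [coeff_one hm, h.2]
    simp [degreeBelow]
  · exact absurd h.1 h1
  · rw [coeff_one hm, if_neg fun h2 => h ⟨h1, h2⟩, mul_zero, smul_zero]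
  · simp

end SuperSeries

open SuperSeries

variable {ι : Type*} [Fintype ι] [LinearOrder ι] {K : Type*} [Field K] {w : ι → ℤ}

/-! ### Functions as polyvector fields of weight zero -/

theorem tVar_injective : Function.Injective (tVar : ι → ι ⊕ₗ ι) := fun a b h => by
  simpa [tVar] using h

theorem tVar_lt_tVar {a b : ι} : tVar a < tVar b ↔ a < b := Sum.Lex.inl_lt_inl_iff

theorem tVar_ne_psiVar (a b : ι) : tVar a ≠ psiVar b := by simp [tVar, psiVar]

theorem polyDegree_tVar (a : ι) : polyDegree w (tVar a) = w a := rfl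

theorem polyDegree_psiVar (a : ι) : polyDegree w (psiVar a) = 1 - w a := rfl

theorem eq_tVar_or_eq_psiVar (x : ι ⊕ₗ ι) : (∃ a, x = tVar a) ∨ ∃ a, x = psiVar a := by
  rcases h : ofLex x with a | a
  · exact Or.inl ⟨a, h⟩
  · exact Or.inr ⟨a, h⟩

theorem mapDomain_tVar_tVar (m : ι →₀ ℕ) (a : ι) : m.mapDomain tVar (tVar a) = m a :=
  Finsupp.mapDomain_apply tVar_injective _ _

theorem mapDomain_tVar_psiVar (m : ι →₀ ℕ) (a : ι) : m.mapDomain tVar (psiVar a) = 0 :=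
  Finsupp.mapDomain_of_notMem_range _ _ fun ⟨b, hb⟩ => tVar_ne_psiVar b a hb

theorem isAdmissible_mapDomain_tVar {m : ι →₀ ℕ} :
    IsAdmissible (polyDegree w) (m.mapDomain tVar) ↔ IsAdmissible w m := by
  constructor
  · intro h a ha
    rw [← mapDomain_tVar_tVar]
    exact h _ ha
  · intro h x hx
    rcases eq_tVar_or_eq_psiVar x with ⟨a, rfl⟩ | ⟨a, rfl⟩
    · rw [mapDomain_tVar_tVar]
      exact h a hx
    · rw [mapDomain_tVar_psiVar]
      exact zero_le_one

theorem weight_mapDomain_tVar (m : ι →₀ ℕ) : weight (m.mapDomain tVar) = 0 :=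
  sum_eq_zero fun a _ => mapDomain_tVar_psiVar m a

theorem weight_add (m n : ι ⊕ₗ ι →₀ ℕ) : weight (m + n) = weight m + weight n := by
  simp [weight, sum_add_distrib]

theorem weight_single_psiVar (a : ι) : weight (Finsupp.single (psiVar a) 1) = 1 := by
  rw [weight, sum_eq_single a]
  · simp
  · intro b _ hb
    rw [Finsupp.single_apply, if_neg]
    intro h
    exact hb (by simpa [psiVar] using h.symm)
  · simp

theorem exists_eq_mapDomain_tVar {m : ι ⊕ₗ ι →₀ ℕ} (h : weight m = 0) :
    ∃ m' : ι →₀ ℕ, m = m'.mapDomain tVar := by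
  refine ⟨m.comapDomain tVar tVar_injective.injOn, ?_⟩
  ext x
  rcases eq_tVar_or_eq_psiVar x with ⟨a, rfl⟩ | ⟨a, rfl⟩
  · rw [mapDomain_tVar_tVar, Finsupp.comapDomain_apply]
  · rw [mapDomain_tVar_psiVar]
    exact (sum_eq_zero_iff.1 h) a (mem_univ a)

theorem monomialDegree_mapDomain_tVar (m : ι →₀ ℕ) :
    monomialDegree (polyDegree w) (m.mapDomain tVar) = monomialDegree w m :=
  Finsupp.sum_mapDomain_index (by simp) (by intros; push_cast; ring)

theorem degreeBelow_mapDomain_tVar (a : ι) (m : ι →₀ ℕ) :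
    degreeBelow (polyDegree w) (tVar a) (m.mapDomain tVar) = degreeBelow w a m := by
  refine (Finsupp.sum_mapDomain_index (by simp) fun b k l => ?_).trans ?_
  · split_ifs <;> push_cast <;> ring
  · simp only [tVar_lt_tVar, polyDegree_tVar]
    rfl

theorem mulExponent_mapDomain_tVar (m n : ι →₀ ℕ) :
    mulExponent (polyDegree w) (m.mapDomain tVar) (n.mapDomain tVar) = mulExponent w m n := by
  refine (Finsupp.sum_mapDomain_index (by simp) fun b k l => ?_).trans ?_
  · rw [← Finsupp.sum_add]
    refine Finsupp.sum_congr fun c _ => ?_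
    split_ifs <;> push_cast <;> ring
  · refine Finsupp.sum_congr fun c _ => ?_
    refine (Finsupp.sum_mapDomain_index (by simp) fun b k l => ?_).trans ?_
    · split_ifs <;> push_cast <;> ring
    · simp only [tVar_lt_tVar, polyDegree_tVar]

theorem coeff_weightZero (m : ι →₀ ℕ) (A : Polyvector K w) :
    coeff m (weightZero A) = coeff (m.mapDomain tVar) A := by
  by_cases h : IsAdmissible w m
  · exact coeff_ofCoeffs _ h A
  · rw [coeff_eq_zero h, coeff_eq_zero (isAdmissible_mapDomain_tVar.not.2 h)]

theorem weightZero_mul (A B : Polyvector K w) :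
    weightZero (A * B) = weightZero A * weightZero B := by
  ext m hm
  rw [coeff_weightZero, coeff_mul (isAdmissible_mapDomain_tVar.2 hm), coeff_mul hm]
  symm
  refine sum_of_injOn (fun x => (x.1.mapDomain tVar, x.2.mapDomain tVar)) ?_ ?_ ?_ ?_
  · rintro ⟨p, q⟩ _ ⟨p', q'⟩ _ h
    rw [Prod.mk.injEq] at h
    exact Prod.ext (Finsupp.mapDomain_injective tVar_injective h.1)
      (Finsupp.mapDomain_injective tVar_injective h.2)
  · rintro ⟨p, q⟩ h
    simp only [mem_coe, HasAntidiagonal.mem_antidiagonal] at h ⊢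
    rw [← h, Finsupp.mapDomain_add]
  · rintro ⟨p, q⟩ h hn
    rw [HasAntidiagonal.mem_antidiagonal] at h
    exfalso
    have hw : weight p + weight q = 0 := by
      rw [← weight_add, ← weight_mapDomain_tVar m, ← h]
    obtain ⟨p', rfl⟩ := exists_eq_mapDomain_tVar (m := p) (by omega)
    obtain ⟨q', rfl⟩ := exists_eq_mapDomain_tVar (m := q) (by omega)
    refine hn ⟨(p', q'), ?_, rfl⟩
    simp only [mem_coe, HasAntidiagonal.mem_antidiagonal]
    apply Finsupp.mapDomain_injective tVar_injective
    rw [← h, Finsupp.mapDomain_add]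
  · rintro ⟨p, q⟩ h
    simp only [coeff_weightZero, mulExponent_mapDomain_tVar]

theorem weightZero_derivLeft (a : ι) (A : Polyvector K w) :
    weightZero (derivLeft (tVar a) A) = derivLeft a (weightZero A) := by
  ext m hm
  rw [coeff_weightZero, coeff_derivLeft _ (isAdmissible_mapDomain_tVar.2 hm),
    coeff_derivLeft _ hm, coeff_weightZero, degreeBelow_mapDomain_tVar, mapDomain_tVar_tVar,
    Finsupp.mapDomain_add, Finsupp.mapDomain_single]
  rfl

theorem weightZero_mem_homogeneous {k : ℤ} {A : Polyvector K w}
    (hA : A ∈ homogeneous K (polyDegree w) k) : weightZero A ∈ homogeneous K w k := by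
  intro m hm
  rw [coeff_weightZero]
  exact hA _ (by rwa [monomialDegree_mapDomain_tVar])

/-- The inclusion of the functions into the polyvector fields. -/
def incl : Functions K w →ₗ[K] Polyvector K w :=
  ofCoeffs fun m =>
    if weight m = 0 then coeff (m.comapDomain tVar tVar_injective.injOn) else 0

theorem coeff_incl_of_weight_ne_zero {m : ι ⊕ₗ ι →₀ ℕ} (hm : weight m ≠ 0) (f : Functions K w) :
    coeff m (incl f) = 0 := by
  by_cases h : IsAdmissible (polyDegree w) m
  · refine (coeff_ofCoeffs _ h f).trans ?_
    rw [if_neg hm, LinearMap.zero_apply]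
  · exact coeff_eq_zero h _

theorem coeff_incl_mapDomain (m : ι →₀ ℕ) (f : Functions K w) :
    coeff (m.mapDomain tVar) (incl f) = coeff m f := by
  by_cases h : IsAdmissible w m
  · refine (coeff_ofCoeffs _ (isAdmissible_mapDomain_tVar.2 h) f).trans ?_
    rw [if_pos (weight_mapDomain_tVar m), Finsupp.comapDomain_mapDomain _ tVar_injective]
  · rw [coeff_eq_zero h, coeff_eq_zero (isAdmissible_mapDomain_tVar.not.2 h)]

theorem weightZero_incl (f : Functions K w) : weightZero (incl f) = f := by
  ext m hm
  rw [coeff_weightZero, coeff_incl_mapDomain]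

/-- Polyvector fields all of whose terms have weight zero are functions. -/
theorem eq_incl_weightZero {A : Polyvector K w} (hA : ∀ m, weight m ≠ 0 → coeff m A = 0) :
    A = incl (weightZero A) := by
  ext m hm
  by_cases h : weight m = 0
  · obtain ⟨m, rfl⟩ := exists_eq_mapDomain_tVar h
    rw [coeff_incl_mapDomain, coeff_weightZero]
  · rw [hA m h, coeff_incl_of_weight_ne_zero h]

theorem incl_mul (f g : Functions K w) : incl (f * g) = incl f * incl g := by
  rw [eq_incl_weightZero (A := incl f * incl g), weightZero_mul, weightZero_incl, weightZero_incl]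
  intro m hm
  by_cases h : IsAdmissible (polyDegree w) m
  · rw [coeff_mul h]
    refine sum_eq_zero fun x hx => ?_
    rw [HasAntidiagonal.mem_antidiagonal] at hx
    have : weight x.1 ≠ 0 ∨ weight x.2 ≠ 0 := by
      rw [← hx, weight_add] at hm
      omega
    rcases this with h | h
    · rw [coeff_incl_of_weight_ne_zero h, zero_mul, smul_zero]
    · rw [coeff_incl_of_weight_ne_zero h, mul_zero, smul_zero]
  · exact coeff_eq_zero h _

theorem incl_one : incl (1 : Functions K w) = 1 := by
  have h : weightZero (1 : Polyvector K w) = 1 := by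
    ext m hm
    rw [coeff_weightZero, coeff_one (isAdmissible_mapDomain_tVar.2 hm), coeff_one hm]
    congr 1
    rw [eq_iff_iff]
    refine ⟨fun h => Finsupp.mapDomain_injective tVar_injective ?_, fun h => ?_⟩
    · rw [h, Finsupp.mapDomain_zero]
    · rw [h, Finsupp.mapDomain_zero]
  rw [← h, ← eq_incl_weightZero]
  intro m hm
  by_cases h : IsAdmissible (polyDegree w) m
  · rw [coeff_one h, if_neg]
    rintro rfl
    exact hm (by simp [weight])
  · exact coeff_eq_zero h _

theorem derivLeft_tVar_incl (a : ι) (f : Functions K w) :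
    derivLeft (tVar a) (incl f) = incl (derivLeft a f) := by
  rw [eq_incl_weightZero (A := derivLeft (tVar a) (incl f)), weightZero_derivLeft,
    weightZero_incl]
  intro m hm
  by_cases h : IsAdmissible (polyDegree w) m
  · rw [coeff_derivLeft _ h, coeff_incl_of_weight_ne_zero, mul_zero, smul_zero]
    rw [weight_add]
    omega
  · exact coeff_eq_zero h _

theorem derivRight_psiVar_incl (a : ι) (f : Functions K w) :
    derivRight (psiVar a) (incl f) = 0 := by
  ext m hm
  rw [coeff_derivRight _ hm, coeff_incl_of_weight_ne_zero, mul_zero, smul_zero, map_zero]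
  rw [weight_add, weight_single_psiVar]
  omega

theorem incl_mem_homogeneous {d : ℤ} {f : Functions K w} (hf : f ∈ homogeneous K w d) :
    incl f ∈ homogeneous K (polyDegree w) d := by
  intro m hm
  by_cases h : weight m = 0
  · obtain ⟨m, rfl⟩ := exists_eq_mapDomain_tVar h
    rw [monomialDegree_mapDomain_tVar] at hm
    rw [coeff_incl_mapDomain, hf m hm]
  · exact coeff_incl_of_weight_ne_zero h f

/-! ### The action of functions on polyvector fields -/

theorem bullet_incl (A : Polyvector K w) (g : Functions K w) :
    bullet A (incl g) = ∑ a, derivRight (psiVar a) A * incl (derivLeft a g) := by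
  simp only [bullet, derivLeft_tVar_incl]

theorem derivRight_psiVar_mul_incl (a : ι) (A : Polyvector K w) {d : ℤ} {g : Functions K w}
    (hg : g ∈ homogeneous K w d) :
    derivRight (psiVar a) (A * incl g) =
      ((1 - w a) * d).negOnePow • (derivRight (psiVar a) A * incl g) := by
  rw [derivRight_mul, derivRight_psiVar_incl, mul_zero, add_zero,
    twist_eq (incl_mem_homogeneous hg), mul_smul_comm, polyDegree_psiVar]

theorem sum_mem_homogeneous {J α : Type*} {w : J → ℤ} {p : ℤ} {s : Finset α}
    {f : α → SuperSeries K w} (h : ∀ i ∈ s, f i ∈ homogeneous K w p) :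
    ∑ i ∈ s, f i ∈ homogeneous K w p := Submodule.sum_mem _ h

theorem homogeneous_congr {J : Type*} {w : J → ℤ} {p q : ℤ} {f : SuperSeries K w}
    (h : f ∈ homogeneous K w p) (hpq : p = q) : f ∈ homogeneous K w q := hpq ▸ h

theorem bullet_mem_homogeneous {p q : ℤ} {A B : Polyvector K w}
    (hA : A ∈ homogeneous K (polyDegree w) p) (hB : B ∈ homogeneous K (polyDegree w) q) :
    bullet A B ∈ homogeneous K (polyDegree w) (p + q - 1) :=
  sum_mem_homogeneous fun a _ => homogeneous_congr
    (mul_mem_homogeneous (derivRight_mem_homogeneous hA _) (derivLeft_mem_homogeneous hB _))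
    (by rw [polyDegree_psiVar, polyDegree_tVar]; ring)

/-- The functions act on the polyvector fields by operators that commute up to sign. -/
theorem bullet_incl_comm (A : Polyvector K w) {p q : ℤ} {f g : Functions K w}
    (hf : f ∈ homogeneous K w p) (hg : g ∈ homogeneous K w q) :
    bullet (bullet A (incl f)) (incl g) =
      ((p - 1) * (q - 1)).negOnePow • bullet (bullet A (incl g)) (incl f) := by
  have expand : ∀ {p q : ℤ} {f g : Functions K w}, f ∈ homogeneous K w p →
      g ∈ homogeneous K w q → bullet (bullet A (incl f)) (incl g) =
        ∑ b, ∑ a, ((1 - w b) * (p - w a)).negOnePow •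
          (derivRight (psiVar b) (derivRight (psiVar a) A) *
            (incl (derivLeft a f) * incl (derivLeft b g))) := fun {p q f g} hf hg => by
    rw [bullet_incl]
    refine sum_congr rfl fun b _ => ?_
    rw [bullet_incl, map_sum, sum_mul]
    refine sum_congr rfl fun a _ => ?_
    rw [derivRight_psiVar_mul_incl b _ (derivLeft_mem_homogeneous hf a), smul_mul_assoc, mul_assoc]
  rw [expand hf hg, expand hg hf, smul_sum, sum_comm]
  refine sum_congr rfl fun a _ => ?_
  rw [smul_sum]
  refine sum_congr rfl fun b _ => ?_
  rw [derivRight_comm, mul_comm_of_mem (incl_mem_homogeneous (derivLeft_mem_homogeneous hf a))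
    (incl_mem_homogeneous (derivLeft_mem_homogeneous hg b)), smul_mul_smul_comm, smul_smul,
    smul_smul, ← Int.negOnePow_add, ← Int.negOnePow_add, ← Int.negOnePow_add, polyDegree_psiVar,
    polyDegree_psiVar]
  congr 1
  apply negOnePow_congr
  push_cast
  generalize (w a : ZMod 2) = a, (w b : ZMod 2) = b, (p : ZMod 2) = p, (q : ZMod 2) = q
  decide +revert

/-! ### Brackets as iterated actions of functions -/

theorem prodHom_zero {J : Type*} [LinearOrder J] {w : J → ℤ} (c : SuperSeries K w)
    (v : Fin 0 → SuperSeries K w) : prodHom 0 c v = c := rfl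

theorem prodHom_succ {J : Type*} [LinearOrder J] {w : J → ℤ} (n : ℕ) (c : SuperSeries K w)
    (v : Fin (n + 1) → SuperSeries K w) :
    prodHom (n + 1) c v = prodHom n c (fun i => v i.castSucc) * v (Fin.last n) := rfl

theorem prodHom_eq_mul {J : Type*} [LinearOrder J] {w : J → ℤ} (n : ℕ) (c : SuperSeries K w)
    (v : Fin n → SuperSeries K w) : prodHom n c v = c * prodHom n 1 v := by
  induction n with
  | zero => rw [prodHom_zero, prodHom_zero, mul_one]
  | succ n ih => rw [prodHom_succ, prodHom_succ, ih, mul_assoc]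

theorem prodHom_one_mem_homogeneous {J : Type*} [LinearOrder J] {w : J → ℤ} {n : ℕ}
    {d : Fin n → ℤ} {v : Fin n → SuperSeries K w} (hv : ∀ i, v i ∈ homogeneous K w (d i)) :
    prodHom n 1 v ∈ homogeneous K w (∑ i, d i) := by
  induction n with
  | zero => simpa [prodHom_zero] using one_mem_homogeneous
  | succ n ih =>
    rw [prodHom_succ, Fin.sum_univ_castSucc]
    exact mul_mem_homogeneous (ih fun i => hv _) (hv _)

theorem component_succ (n : ℕ) (a : Fin (n + 1) → ι) (A : Polyvector K w) :
    component (n + 1) a A =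
      component n (fun i => a i.castSucc) (derivRight (psiVar (a (Fin.last n))) A) := rfl

theorem component_mul_incl {d : ℤ} {u : Functions K w} (hu : u ∈ homogeneous K w d) (n : ℕ)
    (a : Fin n → ι) (A : Polyvector K w) :
    component n a (A * incl u) = (d * ∑ i, (1 - w (a i))).negOnePow • (component n a A * u) := by
  induction n generalizing A with
  | zero =>
    rw [Fin.sum_univ_zero, mul_zero, Int.negOnePow_zero, one_smul]
    exact (weightZero_mul _ _).trans (by rw [weightZero_incl]; rfl)
  | succ n ih =>
    rw [component_succ, component_succ, derivRight_psiVar_mul_incl _ _ hu, map_unit_smul, ih, smul_smul, ← Int.negOnePow_add,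
      Fin.sum_univ_castSucc]
    congr 2
    ring

theorem sum_filter_lt_castSucc {M : Type*} [AddCommMonoid M] {n : ℕ} (d : Fin (n + 1) → M)
    (k : Fin n) : ∑ i with i < k.castSucc, d i = ∑ i : Fin n with i < k, d i.castSucc := by
  rw [sum_filter, sum_filter, Fin.sum_univ_castSucc, if_neg (Fin.castSucc_lt_last k).not_gt,
    add_zero]
  simp only [Fin.castSucc_lt_castSucc_iff]

theorem sum_filter_lt_last {M : Type*} [AddCommMonoid M] {n : ℕ} (d : Fin (n + 1) → M) :
    ∑ i with i < Fin.last n, d i = ∑ i : Fin n, d i.castSucc := by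
  rw [sum_filter, Fin.sum_univ_castSucc]
  simp [Fin.castSucc_lt_last]

theorem bracket_zero (Γ : Polyvector K w) (f : Fin 0 → Functions K w) :
    bracket Γ 0 f = weightZero Γ := by
  rw [bracket_apply Γ 0 (fun _ => 0) f (fun i => i.elim0)]
  simp only [univ_unique, sum_singleton, Fin.sum_univ_zero, Int.negOnePow_zero, one_smul,
    prodHom_zero]
  exact one_smul _ _

theorem bracket_eq_sum (Γ : Polyvector K w) (n : ℕ) (f : Fin n → Functions K w) :
    bracket Γ n f = ∑ a : Fin n → ι,
      ((n.choose 2 : ℤ) + ∑ k : Fin n, w (a k) * (k : ℕ)).negOnePow •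
        (component n a Γ * prodHom n 1 fun i =>
          derivLeft (a i) (twist (∑ k with i < k, w (a k)) (f i))) := by
  simp only [bracket, _root_.sum_apply, _root_.smul_apply,
    MultilinearMap.compLinearMap_apply, LinearMap.comp_apply]
  exact sum_congr rfl fun a _ => by rw [prodHom_eq_mul]

theorem bracket_add (Γ Δ : Polyvector K w) (n : ℕ) (f : Fin n → Functions K w) :
    bracket (Γ + Δ) n f = bracket Γ n f + bracket Δ n f := by
  simp only [bracket_eq_sum, map_add, add_mul, smul_add, sum_add_distrib]

theorem bracket_unit_smul (z : ℤˣ) (Γ : Polyvector K w) (n : ℕ) (f : Fin n → Functions K w) :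
    bracket (z • Γ) n f = z • bracket Γ n f := by
  simp only [bracket_eq_sum, map_unit_smul, smul_mul_assoc, smul_sum]
  exact sum_congr rfl fun a _ => smul_comm _ _ _

/-- The bracket is obtained by letting the last argument act on the polyvector field. -/
theorem bracket_succ (Γ : Polyvector K w) (n : ℕ) {d : Fin (n + 1) → ℤ}
    {f : Fin (n + 1) → Functions K w} (hf : ∀ i, f i ∈ homogeneous K w (d i)) :
    bracket Γ (n + 1) f =
      (n + d (Fin.last n) * (∑ i : Fin n, d i.castSucc + n)).negOnePow •
        bracket (bullet Γ (incl (f (Fin.last n)))) n fun i => f i.castSucc := by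
  rw [bracket_apply Γ (n + 1) d f hf,
    bracket_apply _ n (fun i => d i.castSucc) _ fun i => hf i.castSucc,
    ← (Fin.snocEquiv fun _ => ι).sum_comp, Fintype.sum_prod_type, sum_comm, smul_sum, smul_sum,
    smul_sum]
  refine sum_congr rfl fun a _ => ?_
  have hd : ∀ i, derivLeft (a i) (f i.castSucc) ∈ homogeneous K w (d i.castSucc - w (a i)) :=
    fun i => derivLeft_mem_homogeneous (hf _) _
  rw [bullet_incl, map_sum, prodHom_eq_mul, sum_mul, smul_sum, smul_sum, smul_sum, smul_sum]
  refine sum_congr rfl fun b _ => ?_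
  have hb := derivLeft_mem_homogeneous (hf (Fin.last n)) b
  rw [component_mul_incl hb, smul_mul_assoc, mul_assoc,
    mul_comm_of_mem hb (prodHom_one_mem_homogeneous hd), mul_smul_comm, ← mul_assoc,
    ← prodHom_eq_mul, prodHom_succ, component_succ, Fin.sum_univ_castSucc]
  simp only [Fin.snocEquiv_apply, Fin.snoc_castSucc, Fin.snoc_last, smul_smul,
    ← Int.negOnePow_add, sum_filter_lt_castSucc, sum_filter_lt_last, Fin.val_castSucc, Fin.val_last]
  congr 1
  apply negOnePow_congr
  rw [Nat.choose_succ_succ' n 1, Nat.choose_one_right, sum_sub_distrib, sum_sub_distrib]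
  push_cast
  simp only [sum_const, card_univ, Fintype.card_fin, nsmul_eq_mul, mul_one]
  have h1 := zmod_two_mul_self (w b : ZMod 2)
  have h2 := zmod_two_mul_self (d (Fin.last n) : ZMod 2)
  grind

/-! ### Inserting the last element into a permutation -/

/-- The permutation of `n + 1` elements with one-line notation that of `σ`, with the largest
element inserted at the place `p`. -/
def insertPerm {n : ℕ} (p : Fin (n + 1)) (σ : Equiv.Perm (Fin n)) : Equiv.Perm (Fin (n + 1)) :=
  Equiv.ofBijective
    (Fin.insertNth (α := fun _ => Fin (n + 1)) p (Fin.last n) fun i => (σ i).castSucc) <| by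
    refine Finite.injective_iff_bijective.1 fun i j h => ?_
    rcases Fin.eq_self_or_eq_succAbove p i with hi | ⟨i', hi⟩ <;>
    rcases Fin.eq_self_or_eq_succAbove p j with hj | ⟨j', hj⟩ <;>
    rw [hi, hj] at h ⊢
    · rw [Fin.insertNth_apply_same, Fin.insertNth_apply_succAbove] at h
      exact absurd h.symm (Fin.castSucc_lt_last _).ne
    · rw [Fin.insertNth_apply_same, Fin.insertNth_apply_succAbove] at h
      exact absurd h (Fin.castSucc_lt_last _).ne
    · rw [Fin.insertNth_apply_succAbove, Fin.insertNth_apply_succAbove] at h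
      rw [σ.injective (Fin.castSucc_injective n h)]

theorem insertPerm_self {n : ℕ} (p : Fin (n + 1)) (σ : Equiv.Perm (Fin n)) :
    insertPerm p σ p = Fin.last n :=
  Fin.insertNth_apply_same (α := fun _ => Fin (n + 1)) p (Fin.last n) fun i => (σ i).castSucc

theorem insertPerm_succAbove {n : ℕ} (p : Fin (n + 1)) (σ : Equiv.Perm (Fin n)) (i : Fin n) :
    insertPerm p σ (p.succAbove i) = (σ i).castSucc :=
  Fin.insertNth_apply_succAbove (α := fun _ => Fin (n + 1)) p (Fin.last n)
    (fun i => (σ i).castSucc) i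

theorem insertPerm_bijective (n : ℕ) : Function.Bijective
    fun x : Fin (n + 1) × Equiv.Perm (Fin n) => insertPerm x.1 x.2 := by
  classical
  rw [Fintype.bijective_iff_injective_and_card]
  constructor
  · rintro ⟨p, σ⟩ ⟨q, τ⟩ h
    have h : insertPerm p σ = insertPerm q τ := h
    have hpq : p = q := by
      apply (insertPerm p σ).injective
      rw [insertPerm_self, h, insertPerm_self]
    subst hpq
    congr 1
    ext i
    have h2 := DFunLike.congr_fun h (p.succAbove i)
    rw [insertPerm_succAbove, insertPerm_succAbove] at h2
    rw [Fin.castSucc_injective n h2]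
  · rw [Fintype.card_prod, Fintype.card_perm, Fintype.card_perm, Fintype.card_fin,
      Fintype.card_fin, Nat.factorial_succ]

theorem sum_perm_succ {M : Type*} [AddCommMonoid M] (n : ℕ)
    (F : Equiv.Perm (Fin (n + 1)) → M) :
    ∑ σ, F σ = ∑ p : Fin (n + 1), ∑ σ : Equiv.Perm (Fin n), F (insertPerm p σ) := by
  rw [← Fintype.sum_prod_type']
  exact ((insertPerm_bijective n).sum_comp F).symm

/-- Each inversion contributes the sign `-(-1)^(|v_i||v_j|)`. -/
theorem skewKoszulSign_eq {n : ℕ} (d : Fin n → ℤ) (σ : Equiv.Perm (Fin n)) :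
    skewKoszulSign d σ = ∏ i, ∏ j,
      (if i < j ∧ σ j < σ i then 1 + d (σ i) * d (σ j) else 0).negOnePow := by
  have h : Equiv.Perm.sign σ = ∏ i, ∏ j, if i < j ∧ σ j < σ i then -1 else 1 := by
    rw [Equiv.Perm.sign_eq_prod_prod_Iio, prod_comm]
    refine prod_congr rfl fun j _ => ?_
    rw [← prod_subset (subset_univ (Iio j))]
    · refine prod_congr rfl fun i hi => ?_
      rw [mem_Iio] at hi
      have hne : σ i ≠ σ j := fun h => hi.ne (σ.injective h)
      by_cases h : σ i < σ j
      · rw [if_pos h, if_neg fun h' => h'.2.not_gt h]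
      · rw [if_neg h, if_pos ⟨hi, lt_of_le_of_ne (not_lt.1 h) hne.symm⟩]
    · intro i _ hi
      rw [mem_Iio] at hi
      rw [if_neg fun h => hi h.1]
  rw [skewKoszulSign, h, ← prod_mul_distrib]
  refine prod_congr rfl fun i _ => ?_
  rw [← prod_mul_distrib]
  refine prod_congr rfl fun j _ => ?_
  split_ifs
  · rw [Int.negOnePow_add, mul_comm, Int.negOnePow_one]
  · simp

/-- The sign of inserting the largest element at the place `p`: it passes the elements after
`p`. -/
theorem skewKoszulSign_insertPerm {n : ℕ} (d : Fin (n + 1) → ℤ) (p : Fin (n + 1))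
    (σ : Equiv.Perm (Fin n)) :
    skewKoszulSign d (insertPerm p σ) =
      (∑ j : Fin n, if p < p.succAbove j then 1 + d (Fin.last n) * d (σ j).castSucc
        else 0).negOnePow * skewKoszulSign (fun i => d i.castSucc) σ := by
  rw [skewKoszulSign_eq, skewKoszulSign_eq, Fin.prod_univ_succAbove _ p, ← prod_negOnePow]
  congr 1
  · rw [Fin.prod_univ_succAbove _ p]
    simp [insertPerm_self, insertPerm_succAbove, Fin.castSucc_lt_last]
  · refine prod_congr rfl fun i _ => ?_
    rw [Fin.prod_univ_succAbove _ p]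
    have h : ∀ x : Fin n, ¬ Fin.last n < x.castSucc := fun x => (Fin.castSucc_lt_last x).not_gt
    simp [insertPerm_self, insertPerm_succAbove, h, Fin.succAbove_lt_succAbove_iff]

/-! ### Graded skew-symmetry -/

/-- Letting the argument at an arbitrary place `p` act on the polyvector field. -/
theorem bracket_succAbove (Γ : Polyvector K w) (n : ℕ) {d : Fin (n + 1) → ℤ}
    {f : Fin (n + 1) → Functions K w} (hf : ∀ i, f i ∈ homogeneous K w (d i)) (p : Fin (n + 1)) :
    bracket Γ (n + 1) f =
      (n * (1 + d p) + d p * ∑ i, d (p.succAbove i) +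
        ∑ i : Fin n, if p < p.succAbove i then 1 + d p * d (p.succAbove i) else 0).negOnePow •
        bracket (bullet Γ (incl (f p))) n fun i => f (p.succAbove i) := by
  induction n generalizing Γ with
  | zero =>
    obtain rfl : p = Fin.last 0 := Fin.fin_one_eq_zero p
    rw [bracket_succ Γ 0 hf, bracket_zero, bracket_zero]
    simp
  | succ m ih =>
    rcases Fin.eq_castSucc_or_eq_last p with ⟨q, rfl⟩ | rfl
    · have h1 : ∀ i : Fin m, q.castSucc.succAbove i.castSucc = (q.succAbove i).castSucc :=
        fun i => Fin.castSucc_succAbove_castSucc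
      have h2 : q.castSucc.succAbove (Fin.last m) = Fin.last (m + 1) := by simp
      rw [bracket_succ Γ (m + 1) hf, ih _ (fun i => hf i.castSucc) q,
        bracket_succ _ m (fun i => hf (q.castSucc.succAbove i))]
      simp only [h1, h2]
      rw [bullet_incl_comm Γ (hf (Fin.last (m + 1))) (hf q.castSucc),
        bracket_unit_smul, Fin.sum_univ_succAbove (fun i => d (Fin.castSucc i)) q,
        Fin.sum_univ_castSucc (n := m) (f := fun i => d (q.castSucc.succAbove i)),
        Fin.sum_univ_castSucc (n := m)]
      simp only [h1, h2, Fin.castSucc_lt_last, Fin.castSucc_lt_castSucc_iff, if_true, smul_smul,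
        ← Int.negOnePow_add]
      generalize (∑ i : Fin m, if q < q.succAbove i then
        1 + d q.castSucc * d (q.succAbove i).castSucc else 0) = S
      generalize ∑ i, d (q.succAbove i).castSucc = D, d q.castSucc = x,
        d (Fin.last (m + 1)) = y
      congr 1
      apply negOnePow_congr
      push_cast
      generalize (D : ZMod 2) = D, (S : ZMod 2) = S, (x : ZMod 2) = x, (y : ZMod 2) = y,
        (m : ZMod 2) = m
      decide +revert
    · rw [bracket_succ Γ (m + 1) hf]
      have h : ∀ i : Fin (m + 1), ¬ Fin.last (m + 1) < i.castSucc :=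
        fun i => (Fin.castSucc_lt_last i).not_gt
      simp only [Fin.succAbove_last, h, if_false, sum_const_zero, add_zero]
      congr 2
      push_cast
      ring

theorem bracket_perm (Γ : Polyvector K w) (n : ℕ) {d : Fin n → ℤ}
    {f : Fin n → Functions K w} (hf : ∀ i, f i ∈ homogeneous K w (d i))
    (σ : Equiv.Perm (Fin n)) :
    bracket Γ n (fun i => f (σ i)) = skewKoszulSign d σ • bracket Γ n f := by
  induction n generalizing Γ with
  | zero =>
    rw [bracket_zero, bracket_zero, skewKoszulSign_eq]
    simp
  | succ n ih =>
    obtain ⟨⟨p, σ⟩, rfl⟩ := (insertPerm_bijective n).2 σ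
    rw [bracket_succAbove Γ n (fun i => hf _) p, bracket_succ Γ n hf]
    simp only [insertPerm_self, insertPerm_succAbove]
    rw [ih _ (fun i => hf i.castSucc) σ, skewKoszulSign_insertPerm, smul_smul, smul_smul,
      Equiv.sum_comp σ fun i => d i.castSucc, mul_right_comm,
      ← Int.negOnePow_add]
    congr 3
    ring

/-! ### Degrees and the Leibniz rule -/

theorem bracket_mem_homogeneous {k : ℤ} {Γ : Polyvector K w}
    (hΓ : Γ ∈ homogeneous K (polyDegree w) k) (n : ℕ) {d : Fin n → ℤ} {f : Fin n → Functions K w}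
    (hf : ∀ i, f i ∈ homogeneous K w (d i)) :
    bracket Γ n f ∈ homogeneous K w (k - n + ∑ i, d i) := by
  induction n generalizing Γ k with
  | zero =>
    rw [bracket_zero]
    exact homogeneous_congr (weightZero_mem_homogeneous hΓ) (by simp)
  | succ n ih =>
    rw [bracket_succ Γ n hf]
    refine unit_smul_mem_homogeneous _ (homogeneous_congr
      (ih (bullet_mem_homogeneous hΓ (incl_mem_homogeneous (hf _))) fun i => hf _) ?_)
    rw [Fin.sum_univ_castSucc]
    push_cast
    ring

/-- Right multiplication by functions commutes with their action up to sign. -/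
theorem bullet_mul_incl (A : Polyvector K w) {p q : ℤ} {g h : Functions K w}
    (hg : g ∈ homogeneous K w p) (hh : h ∈ homogeneous K w q) :
    bullet (A * incl h) (incl g) = (q * (1 + p)).negOnePow • (bullet A (incl g) * incl h) := by
  rw [bullet_incl, bullet_incl, sum_mul, smul_sum]
  refine sum_congr rfl fun a _ => ?_
  rw [derivRight_psiVar_mul_incl a A hh, smul_mul_assoc, mul_assoc,
    mul_comm_of_mem (incl_mem_homogeneous hh)
      (incl_mem_homogeneous (derivLeft_mem_homogeneous hg a)), mul_smul_comm, smul_smul,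
    ← Int.negOnePow_add, mul_assoc]
  congr 1
  apply negOnePow_congr
  push_cast
  generalize (p : ZMod 2) = p, (q : ZMod 2) = q, (w a : ZMod 2) = a
  decide +revert

theorem bracket_mul_incl (A : Polyvector K w) {q : ℤ} {h : Functions K w}
    (hh : h ∈ homogeneous K w q) (n : ℕ) {d : Fin n → ℤ} {f : Fin n → Functions K w}
    (hf : ∀ i, f i ∈ homogeneous K w (d i)) :
    bracket (A * incl h) n f = (q * (n + ∑ i, d i)).negOnePow • (bracket A n f * h) := by
  induction n generalizing A with
  | zero => simp [bracket_zero, weightZero_mul, weightZero_incl]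
  | succ n ih =>
    rw [bracket_succ _ n hf, bracket_succ _ n hf, bullet_mul_incl _ (hf _) hh,
      bracket_unit_smul, ih _ fun i => hf _, Fin.sum_univ_castSucc, smul_mul_assoc, smul_smul,
      smul_smul, smul_smul, ← Int.negOnePow_add, ← Int.negOnePow_add, ← Int.negOnePow_add]
    congr 2
    push_cast
    ring

/-- The action of functions on polyvector fields is a derivation in the function. -/
theorem bullet_incl_mul (A : Polyvector K w) {p q : ℤ} {g h : Functions K w}
    (hg : g ∈ homogeneous K w p) (hh : h ∈ homogeneous K w q) :
    bullet A (incl (g * h)) =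
      bullet A (incl g) * incl h + (p * q).negOnePow • (bullet A (incl h) * incl g) := by
  rw [bullet_incl, bullet_incl, bullet_incl, sum_mul, sum_mul, smul_sum, ← sum_add_distrib]
  refine sum_congr rfl fun a _ => ?_
  rw [derivLeft_mul, map_add, incl_mul, incl_mul, mul_add, mul_assoc, twist_eq hg, map_unit_smul,
    smul_mul_assoc, mul_comm_of_mem (incl_mem_homogeneous hg)
      (incl_mem_homogeneous (derivLeft_mem_homogeneous hh a)), smul_smul, ← Int.negOnePow_add,
    mul_smul_comm, mul_assoc]
  congr 3
  ring

theorem sum_succAbove_ite {M : Type*} [AddCommMonoid M] {n : ℕ} (j : Fin (n + 1))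
    (d : Fin (n + 1) → M) :
    (∑ i : Fin n, if j < j.succAbove i then d (j.succAbove i) else 0) =
      ∑ i with j < i, d i := by
  rw [sum_filter, Fin.sum_univ_succAbove _ j, if_neg (lt_irrefl j), zero_add]

theorem update_mem_homogeneous {n : ℕ} {d : Fin n → ℤ} {f : Fin n → Functions K w}
    (hf : ∀ i, f i ∈ homogeneous K w (d i)) (j : Fin n) {p : ℤ} {g : Functions K w}
    (hg : g ∈ homogeneous K w p) (i : Fin n) :
    Function.update f j g i ∈ homogeneous K w (Function.update d j p i) := by
  rcases eq_or_ne i j with rfl | h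
  · simpa using hg
  · simpa [h] using hf i

/-- Splitting off an argument that varies; the dependence of the sign on its degree is explicit. -/
theorem bracket_update (Γ : Polyvector K w) (n : ℕ) {d : Fin (n + 1) → ℤ}
    {f : Fin (n + 1) → Functions K w} (hf : ∀ i, f i ∈ homogeneous K w (d i)) (j : Fin (n + 1))
    {p : ℤ} {g : Functions K w} (hg : g ∈ homogeneous K w p) :
    bracket Γ (n + 1) (Function.update f j g) =
      ((n + ∑ i with j < i, 1) +
        p * (n + ∑ i, d (j.succAbove i) + ∑ i with j < i, d i)).negOnePow •
        bracket (bullet Γ (incl g)) n fun i => f (j.succAbove i) := by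
  rw [bracket_succAbove Γ n (update_mem_homogeneous hf j hg) j]
  simp only [Function.update_self, Function.update_of_ne (Fin.succAbove_ne j _)]
  rw [← sum_succAbove_ite j d, ← sum_succAbove_ite j fun _ => (1 : ℤ)]
  congr 2
  have : ∀ i : Fin n, (if j < j.succAbove i then 1 + p * d (j.succAbove i) else 0) =
      (if j < j.succAbove i then 1 else 0) +
        p * if j < j.succAbove i then d (j.succAbove i) else 0 := fun i => by
    split_ifs <;> simp
  simp only [this, sum_add_distrib, ← mul_sum]
  ring

theorem isGradedLeibnizRight_bracket (Γ : Polyvector K w) (n : ℕ) :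
    IsGradedLeibnizRight (bracket Γ n) := by
  intro j d f hf p q g h hg hh
  cases n with
  | zero => exact j.elim0
  | succ n =>
    rw [bracket_update Γ n hf j (mul_mem_homogeneous hg hh), bracket_update Γ n hf j hg,
      bracket_update Γ n hf j hh, bullet_incl_mul Γ hg hh, bracket_add, bracket_unit_smul,
      bracket_mul_incl _ hg n fun i => hf _, bracket_mul_incl _ hh n fun i => hf _,
      smul_add, add_comm]
    simp only [smul_mul_assoc, smul_smul, ← Int.negOnePow_add]
    generalize ∑ i with j < i, (1 : ℤ) = c, ∑ i with j < i, d i = S,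
      ∑ i, d (j.succAbove i) = D
    congr 2 <;> apply negOnePow_congr <;> push_cast <;>
    generalize (c : ZMod 2) = c, (S : ZMod 2) = S, (D : ZMod 2) = D, (p : ZMod 2) = p,
        (q : ZMod 2) = q, (n : ZMod 2) = n <;>
    decide +revert

theorem sum_update_eq {n : ℕ} (d : Fin n → ℤ) (j : Fin n) (q : ℤ) :
    ∑ i, Function.update d j q i = q + ∑ i with i < j, d i + ∑ i with j < i, d i := by
  rw [sum_update_of_mem (mem_univ j), add_assoc]
  congr 1
  rw [← sum_union]
  · refine sum_congr ?_ fun _ _ => rfl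
    ext i
    simp [lt_or_lt_iff_ne]
  · rw [disjoint_filter]
    exact fun i _ h => h.not_gt

theorem isGradedLeibniz_bracket {k : ℤ} {Γ : Polyvector K w}
    (hΓ : Γ ∈ homogeneous K (polyDegree w) k) (n : ℕ) :
    IsGradedLeibniz (k - n) (bracket Γ n) := by
  intro j d f hf p q g h hg hh
  rw [isGradedLeibnizRight_bracket Γ n j d f hf p q g h hg hh,
    mul_comm_of_mem (bracket_mem_homogeneous hΓ n (update_mem_homogeneous hf j hh)) hg, smul_smul,
    ← Int.negOnePow_add, sum_update_eq]
  congr 2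
  apply negOnePow_congr
  push_cast
  have := zmod_two_mul_self (p : ZMod 2)
  grind

/-! ### A polyvector field is determined by its brackets of coordinate functions -/

theorem bullet_incl_var (A : Polyvector K w) (a : ι) :
    bullet A (incl (var a)) = derivRight (psiVar a) A := by
  rw [bullet_incl, sum_eq_single a]
  · rw [derivLeft_var, if_pos rfl, incl_one, mul_one]
  · intro b _ hb
    rw [derivLeft_var, if_neg hb, map_zero, mul_zero]
  · simp

/-- By induction on the weight: a coefficient at a monomial containing `ψ_b` is a nonzero multiple of
a coefficient of `∂A/∂ψ_b`, the brackets of which are brackets of `A` with last argument `t^b`. -/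
theorem coeff_eq_zero_of_bracket_var [CharZero K] (m : ι ⊕ₗ ι →₀ ℕ) (A : Polyvector K w) (k : ℤ)
    (hA : ∀ (n : ℕ) (a : Fin n → ι),
      bracket A n (fun i => var (a i)) ∈ homogeneous K w (k - n + ∑ i, w (a i)))
    (hm : monomialDegree (polyDegree w) m ≠ k) : coeff m A = 0 := by
  by_cases hadm : IsAdmissible (polyDegree w) m
  swap
  · exact coeff_eq_zero hadm A
  induction h : weight m generalizing m A k with
  | zero =>
    obtain ⟨m, rfl⟩ := exists_eq_mapDomain_tVar h
    have h0 := hA 0 Fin.elim0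
    rw [bracket_zero] at h0
    rw [← coeff_weightZero]
    refine h0 m ?_
    rw [monomialDegree_mapDomain_tVar] at hm
    simpa using hm
  | succ N ih =>
    obtain ⟨b, hb⟩ : ∃ b, m (psiVar b) ≠ 0 := by
      by_contra! h0
      rw [weight, sum_eq_zero fun a _ => h0 a] at h
      omega
    obtain ⟨m, rfl⟩ : ∃ m', m = m' + Finsupp.single (psiVar b) 1 :=
      ⟨m - Finsupp.single (psiVar b) 1, (tsub_add_cancel_of_le
        (Finsupp.single_le_iff.2 (Nat.one_le_iff_ne_zero.2 hb))).symm⟩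
    have h1 := ih m (derivRight (psiVar b) A) (k - (1 - w b)) (fun n a => by
      have h2 := hA (n + 1) (Fin.snoc (α := fun _ => ι) a b)
      rw [bracket_succ A n fun i => var_mem_homogeneous _] at h2
      simp only [Fin.snoc_castSucc, Fin.snoc_last, bullet_incl_var, Fin.sum_univ_castSucc] at h2
      have h3 := unit_smul_mem_homogeneous (n + w b * (∑ i, w (a i) + n)).negOnePow h2
      rw [smul_smul, Int.units_mul_self, one_smul] at h3
      refine homogeneous_congr h3 ?_
      push_cast
      ring) (fun h2 => hm (by
        rw [monomialDegree_add, monomialDegree_single, h2, polyDegree_psiVar]; ring))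
      hadm.of_add_left (by rw [weight_add, weight_single_psiVar] at h; omega)
    rw [coeff_derivRight _ hadm.of_add_left, smul_eq_zero_iff_eq] at h1
    exact (mul_eq_zero.1 h1).resolve_left (Nat.cast_add_one_ne_zero _)

theorem mem_homogeneous_of_bracket_var [CharZero K] {A : Polyvector K w} {k : ℤ}
    (hA : ∀ (n : ℕ) (a : Fin n → ι),
      bracket A n (fun i => var (a i)) ∈ homogeneous K w (k - n + ∑ i, w (a i))) :
    A ∈ homogeneous K (polyDegree w) k :=
  fun m hm => coeff_eq_zero_of_bracket_var m A k hA hm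

theorem eq_zero_of_bracket_var [CharZero K] {A : Polyvector K w}
    (hA : ∀ (n : ℕ) (a : Fin n → ι), bracket A n (fun i => var (a i)) = 0) : A = 0 := by
  ext m hm
  rw [map_zero]
  refine coeff_eq_zero_of_bracket_var m A (monomialDegree (polyDegree w) m + 1) (fun n a => ?_)
    (by omega)
  rw [hA]
  exact Submodule.zero_mem _

/-! ### Functions act by derivations of the Schouten bracket -/

/-- The contraction of the second derivatives of a function `g` with two polyvector fields `A`, `B`
(`B` of degree `q`): the failure of `• g` to be a derivation of the product `•`. -/
def hessian (q : ℤ) (A B : Polyvector K w) (g : Functions K w) : Polyvector K w :=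
  ∑ a, ∑ b, (w a * (q - 1 + w b)).negOnePow •
    (derivRight (psiVar a) A * derivRight (psiVar b) B * incl (derivLeft a (derivLeft b g)))

/-- The operator `• g` is a derivation of `•` up to the second derivatives of `g`. -/
theorem bullet_bullet_incl (A : Polyvector K w) {B : Polyvector K w} {g : Functions K w} {q r : ℤ}
    (hB : B ∈ homogeneous K (polyDegree w) q) (hg : g ∈ homogeneous K w r) :
    bullet (bullet A B) (incl g) + hessian q A B g =
      bullet A (bullet B (incl g)) +
        ((q + 1) * (r + 1)).negOnePow • bullet (bullet A (incl g)) B := by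
  have h1 : bullet (bullet A B) (incl g) = ∑ a, ∑ b,
      (derivRight (psiVar b) (derivRight (psiVar a) A) *
          twist (polyDegree w (psiVar b)) (derivLeft (tVar a) B) +
        derivRight (psiVar a) A * derivRight (psiVar b) (derivLeft (tVar a) B)) *
        incl (derivLeft b g) := by
    rw [bullet_incl, sum_comm]
    refine sum_congr rfl fun b _ => ?_
    rw [bullet, map_sum, sum_mul]
    exact sum_congr rfl fun a _ => by rw [derivRight_mul]
  have h2 : bullet A (bullet B (incl g)) = ∑ a, ∑ b, derivRight (psiVar a) A *
      (derivLeft (tVar a) (derivRight (psiVar b) B) * incl (derivLeft b g) +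
        twist (polyDegree w (tVar a)) (derivRight (psiVar b) B) *
          incl (derivLeft a (derivLeft b g))) := by
    rw [bullet]
    refine sum_congr rfl fun a _ => ?_
    rw [bullet_incl, map_sum, mul_sum]
    exact sum_congr rfl fun b _ => by rw [derivLeft_mul, derivLeft_tVar_incl]
  have h3 : bullet (bullet A (incl g)) B = ∑ a, ∑ b, ((1 - w a) * (r - w b)).negOnePow •
      (derivRight (psiVar a) (derivRight (psiVar b) A) * incl (derivLeft b g)) *
        derivLeft (tVar a) B := by
    rw [bullet]
    refine sum_congr rfl fun a _ => ?_
    rw [bullet_incl, map_sum, sum_mul]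
    exact sum_congr rfl fun b _ => by
      rw [derivRight_psiVar_mul_incl a _ (derivLeft_mem_homogeneous hg b)]
  rw [h1, h2, h3, hessian, smul_sum, ← sum_add_distrib, ← sum_add_distrib]
  refine sum_congr rfl fun a _ => ?_
  rw [smul_sum, ← sum_add_distrib, ← sum_add_distrib]
  refine sum_congr rfl fun b _ => ?_
  have hBa := derivLeft_mem_homogeneous hB (tVar a)
  have hBb := derivRight_mem_homogeneous hB (psiVar b)
  have hgb := incl_mem_homogeneous (derivLeft_mem_homogeneous hg b)
  rw [twist_eq hBa, twist_eq hBb, derivRight_comm (psiVar b) (psiVar a), derivRight_derivLeft]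
  simp only [add_mul, mul_add, smul_mul_assoc, mul_smul_comm, smul_smul, mul_assoc,
    ← Int.negOnePow_add]
  rw [mul_comm_of_mem hBa hgb]
  simp only [mul_smul_comm, smul_smul, ← Int.negOnePow_add, polyDegree_psiVar, polyDegree_tVar]
  have e1 : ((1 - w b) * (q - w a) + (1 - w b) * (1 - w a) + (q - w a) * (r - w b)).negOnePow =
      (q * r + 1 * r + (q * 1 + 1 * 1) + (1 - w a) * (r - w b)).negOnePow := by
    apply negOnePow_congr
    push_cast
    generalize (q : ZMod 2) = q, (r : ZMod 2) = r, (w a : ZMod 2) = a, (w b : ZMod 2) = b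
    decide +revert
  have e2 : (w a * (q - 1) + w a * w b).negOnePow = (w a * (q - (1 - w b))).negOnePow := by
    congr 1
    ring
  rw [e1, e2]
  abel

/-- The second derivatives of a function are graded symmetric. -/
theorem hessian_swap {A B : Polyvector K w} {p q : ℤ} (hA : A ∈ homogeneous K (polyDegree w) p)
    (hB : B ∈ homogeneous K (polyDegree w) q) (g : Functions K w) :
    hessian p B A g = ((p + 1) * (q + 1)).negOnePow • hessian q A B g := by
  rw [hessian, hessian, sum_comm, smul_sum]
  refine sum_congr rfl fun a _ => ?_
  rw [smul_sum]
  refine sum_congr rfl fun b _ => ?_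
  rw [mul_comm_of_mem (derivRight_mem_homogeneous hB (psiVar b))
    (derivRight_mem_homogeneous hA (psiVar a)), derivLeft_comm b a, map_unit_smul, mul_smul_comm,
    smul_mul_assoc, smul_smul, smul_smul, smul_smul, ← Int.negOnePow_add, ← Int.negOnePow_add,
    ← Int.negOnePow_add, polyDegree_psiVar, polyDegree_psiVar]
  congr 1
  apply negOnePow_congr
  push_cast
  generalize (p : ZMod 2) = p, (q : ZMod 2) = q, (w a : ZMod 2) = a, (w b : ZMod 2) = b
  decide +revert

theorem bullet_add_left (A A' B : Polyvector K w) :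
    bullet (A + A') B = bullet A B + bullet A' B := by
  simp only [bullet, map_add, add_mul, sum_add_distrib]

theorem bullet_unit_smul_left (z : ℤˣ) (A B : Polyvector K w) :
    bullet (z • A) B = z • bullet A B := by
  simp only [bullet, map_unit_smul, smul_mul_assoc, smul_sum]

/-- The action of a function on polyvector fields is a graded derivation of the Schouten
bracket: in the bracket the second derivatives of the function cancel. -/
theorem bullet_schouten_incl {A B : Polyvector K w} {g : Functions K w} {p q r : ℤ}
    (hA : A ∈ homogeneous K (polyDegree w) p) (hB : B ∈ homogeneous K (polyDegree w) q)
    (hg : g ∈ homogeneous K w r) :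
    bullet (schouten p q A B) (incl g) = schouten p (q + r - 1) A (bullet B (incl g)) +
      ((q + 1) * (r + 1)).negOnePow • schouten (p + r - 1) q (bullet A (incl g)) B := by
  have h1 := eq_sub_of_add_eq (bullet_bullet_incl A hB hg)
  have h2 := eq_sub_of_add_eq (bullet_bullet_incl B hA hg)
  rw [schouten, schouten, schouten, bullet_add_left, bullet_unit_smul_left, h1, h2,
    hessian_swap hA hB]
  simp only [smul_sub, smul_add, smul_smul, ← Int.negOnePow_add]
  have e1 : (p * q + p + q + (p + 1) * (q + 1)).negOnePow = -1 := by
    rw [← Int.negOnePow_one]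
    apply negOnePow_congr
    push_cast
    generalize (p : ZMod 2) = p, (q : ZMod 2) = q
    decide +revert
  have e2 : (p * q + p + q + (p + 1) * (r + 1)).negOnePow =
      (p * (q + r - 1) + p + (q + r - 1)).negOnePow := by
    apply negOnePow_congr
    push_cast
    generalize (p : ZMod 2) = p, (q : ZMod 2) = q, (r : ZMod 2) = r
    decide +revert
  have e3 : ((q + 1) * (r + 1) + ((p + r - 1) * q + (p + r - 1) + q)).negOnePow =
      (p * q + p + q).negOnePow := by
    apply negOnePow_congr
    push_cast
    generalize (p : ZMod 2) = p, (q : ZMod 2) = q, (r : ZMod 2) = r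
    decide +revert
  rw [e1, e2, e3, Units.neg_smul, one_smul]
  abel

/-! ### Unshuffles and insertion of the last element -/

theorem val_succAbove {n : ℕ} (p : Fin (n + 1)) (i : Fin n) :
    (p.succAbove i : ℕ) = if (i : ℕ) < p then (i : ℕ) else i + 1 := by
  rw [Fin.succAbove]
  simp only [Fin.lt_def, Fin.val_castSucc]
  split_ifs <;> simp

theorem insertPerm_lt_insertPerm {n : ℕ} (p : Fin (n + 1)) (σ : Equiv.Perm (Fin n)) {i j : Fin n} :
    insertPerm p σ (p.succAbove i) < insertPerm p σ (p.succAbove j) ↔ σ i < σ j := by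
  rw [insertPerm_succAbove, insertPerm_succAbove, Fin.castSucc_lt_castSucc_iff]

/-- A permutation with the largest value at `p` can only increase on `S ∋ p` if `p` is the last
element of `S`. -/
theorem strictMonoOn_insertPerm {n : ℕ} {p : Fin (n + 1)} {σ : Equiv.Perm (Fin n)}
    {S : Set (Fin (n + 1))} :
    StrictMonoOn (insertPerm p σ) S ↔
      StrictMonoOn σ (p.succAbove ⁻¹' S) ∧ (p ∈ S → ∀ i ∈ S, i ≤ p) := by
  constructor
  · intro h
    refine ⟨fun i hi j hj hij => (insertPerm_lt_insertPerm p σ).1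
      (h hi hj (Fin.strictMono_succAbove p hij)), fun hp i hi => ?_⟩
    by_contra hpi
    have := h hp hi (not_le.1 hpi)
    rw [insertPerm_self] at this
    exact this.not_ge (Fin.le_last _)
  · rintro ⟨h, hp⟩ i hi j hj hij
    rcases Fin.eq_self_or_eq_succAbove p i with rfl | ⟨i, rfl⟩
    · exact absurd (hp hi j hj) (not_le.2 hij)
    · rcases Fin.eq_self_or_eq_succAbove p j with hj' | ⟨j, rfl⟩
      · rw [hj', insertPerm_self, insertPerm_succAbove]
        exact Fin.castSucc_lt_last _
      · exact (insertPerm_lt_insertPerm p σ).2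
          (h hi hj ((Fin.strictMono_succAbove p).lt_iff_lt.1 hij))

/-- In an unshuffle the largest element is the last one of one of the two blocks. -/
theorem isUnshuffle_insertPerm {n : ℕ} (s : Fin (n + 2)) (p : Fin (n + 1))
    (σ : Equiv.Perm (Fin n)) :
    IsUnshuffle (s : ℕ) (insertPerm p σ) ↔
      (p = Fin.last n ∧ (s : ℕ) ≤ n ∧ IsUnshuffle (s : ℕ) σ) ∨
        (s = p.succ ∧ IsUnshuffle (p : ℕ) σ) := by
  have hs := s.2
  have hp := p.2
  rw [IsUnshuffle, strictMonoOn_insertPerm, strictMonoOn_insertPerm]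
  simp only [Set.mem_ofPred_eq, Set.preimage_ofPred_eq, val_succAbove, Fin.le_def]
  by_cases hps : (p : ℕ) < s
  · have h1 : (∀ i : Fin (n + 1), (i : ℕ) < s → (i : ℕ) ≤ p) ↔ (s : ℕ) = p + 1 := by
      constructor
      · intro h
        by_contra hne
        have := h ⟨p + 1, by omega⟩ (by simp only; omega)
        simp at this
      · intro h i hi
        omega
    have h2 : s = p.succ ↔ (s : ℕ) = p + 1 := by rw [Fin.ext_iff, Fin.val_succ]
    have h3 : ¬ (p = Fin.last n ∧ (s : ℕ) ≤ n ∧ IsUnshuffle (s : ℕ) σ) := by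
      rintro ⟨rfl, h, -⟩
      rw [Fin.val_last] at hps
      omega
    rw [or_iff_right h3, h2, IsUnshuffle]
    simp only [hps, true_imp_iff, h1, not_le.2 hps, false_imp_iff, and_true]
    constructor
    · rintro ⟨⟨h4, h5⟩, h6⟩
      refine ⟨h5, fun i hi j hj hij => h4 ?_ ?_ hij, fun i hi j hj hij => h6 ?_ ?_ hij⟩ <;>
      simp only [Set.mem_ofPred_eq] at hi hj ⊢ <;> split_ifs <;> omega
    · rintro ⟨h5, h4, h6⟩
      refine ⟨⟨fun i hi j hj hij => h4 ?_ ?_ hij, h5⟩, fun i hi j hj hij => h6 ?_ ?_ hij⟩ <;>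
      simp only [Set.mem_ofPred_eq] at hi hj ⊢ <;> split_ifs at hi hj <;> omega
  · have h1 : (∀ i : Fin (n + 1), (s : ℕ) ≤ i → (i : ℕ) ≤ p) ↔ p = Fin.last n := by
      rw [Fin.ext_iff, Fin.val_last]
      constructor
      · intro h
        have := h (Fin.last n) (by rw [Fin.val_last]; omega)
        rw [Fin.val_last] at this
        omega
      · intro h i hi
        omega
    have h3 : ¬ (s = p.succ ∧ IsUnshuffle (p : ℕ) σ) := by
      rintro ⟨rfl, -⟩
      simp at hps
    rw [or_iff_left h3, IsUnshuffle]
    simp only [hps, not_lt.1 hps, true_imp_iff, h1, false_imp_iff, and_true]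
    constructor
    · rintro ⟨h4, h6, rfl⟩
      rw [Fin.val_last] at *
      refine ⟨rfl, by omega, fun i hi j hj hij => h4 ?_ ?_ hij,
        fun i hi j hj hij => h6 ?_ ?_ hij⟩ <;>
      simp only [Set.mem_ofPred_eq] at hi hj ⊢ <;> split_ifs <;> omega
    · rintro ⟨rfl, h5, h4, h6⟩
      rw [Fin.val_last] at *
      refine ⟨fun i hi j hj hij => h4 ?_ ?_ hij, fun i hi j hj hij => h6 ?_ ?_ hij, rfl⟩ <;>
      simp only [Set.mem_ofPred_eq] at hi hj ⊢ <;> split_ifs at hi hj <;> omega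

open Classical in
/-- A sum over unshuffles, split according to the block containing the largest element. -/
theorem sum_isUnshuffle_succ {M : Type*} [AddCommMonoid M] {n : ℕ}
    (H : Fin (n + 2) → Equiv.Perm (Fin (n + 1)) → M) :
    ∑ s : Fin (n + 2), ∑ σ : Equiv.Perm (Fin (n + 1)) with IsUnshuffle (s : ℕ) σ, H s σ =
      (∑ s : Fin (n + 1), ∑ σ : Equiv.Perm (Fin n) with IsUnshuffle (s : ℕ) σ,
        H s.castSucc (insertPerm (Fin.last n) σ)) +
      ∑ s : Fin (n + 1), ∑ σ : Equiv.Perm (Fin n) with IsUnshuffle (s : ℕ) σ,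
        H s.succ (insertPerm s σ) := by
  have split : ∀ (s : Fin (n + 2)) (p : Fin (n + 1)) (σ : Equiv.Perm (Fin n)),
      (if IsUnshuffle (s : ℕ) (insertPerm p σ) then H s (insertPerm p σ) else 0) =
        (if p = Fin.last n then if (s : ℕ) ≤ n ∧ IsUnshuffle (s : ℕ) σ then
          H s (insertPerm p σ) else 0 else 0) +
        (if s = p.succ then if IsUnshuffle (p : ℕ) σ then H s (insertPerm p σ) else 0 else 0) := by
    intro s p σ
    rw [isUnshuffle_insertPerm, ← ite_and, ← ite_and]
    by_cases h1 : p = Fin.last n ∧ (s : ℕ) ≤ n ∧ IsUnshuffle (s : ℕ) σ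
    · have h2 : ¬ (s = p.succ ∧ IsUnshuffle (p : ℕ) σ) := by
        rintro ⟨rfl, -⟩
        obtain ⟨rfl, h, -⟩ := h1
        simp at h
      rw [if_pos (Or.inl h1), if_pos h1, if_neg h2, add_zero]
    · by_cases h2 : s = p.succ ∧ IsUnshuffle (p : ℕ) σ
      · rw [if_pos (Or.inr h2), if_neg h1, if_pos h2, zero_add]
      · rw [if_neg (not_or.2 ⟨h1, h2⟩), if_neg h1, if_neg h2, add_zero]
  simp only [sum_filter, sum_perm_succ, split, sum_add_distrib]
  congr 1
  · rw [Fin.sum_univ_castSucc]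
    simp only [Fin.val_last, Nat.not_succ_le_self, false_and, if_false, ite_self, sum_const_zero,
      add_zero]
    refine sum_congr rfl fun s _ => ?_
    rw [sum_comm]
    refine sum_congr rfl fun σ _ => ?_
    rw [sum_ite_eq' univ (Fin.last n), if_pos (mem_univ _)]
    have : (s : ℕ) ≤ n := Nat.lt_succ_iff.1 s.2
    simp only [Fin.val_castSucc, this, true_and]
  · rw [sum_comm]
    refine sum_congr rfl fun p _ => ?_
    rw [sum_comm]
    refine sum_congr rfl fun σ _ => ?_
    rw [sum_ite_eq' univ p.succ, if_pos (mem_univ _)]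

/-! ### The Jacobi expression of two polyvector fields -/

theorem sum_eq_sum_blocks {n s r : ℕ} (h : s + r = n) (F : Fin n → ℤ) :
    ∑ i, F i = (∑ i : Fin s, F ⟨i, by omega⟩) + ∑ k : Fin r, F ⟨s + k, by omega⟩ := by
  subst h
  exact Fin.sum_univ_add F

theorem bracket_cons_unit_smul (Γ : Polyvector K w) (n : ℕ) (z : ℤˣ) (x : Functions K w)
    (v : Fin n → Functions K w) :
    bracket Γ (n + 1) (Fin.cons (z • x) v) = z • bracket Γ (n + 1) (Fin.cons x v) := by
  have h := map_unit_smul ((bracket Γ (n + 1)).curryLeft) z x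
  have h2 := DFunLike.congr_fun h v
  rw [Units.smul_def, Units.smul_def] at h2 ⊢
  exact h2

/-- The summand `L_{r+1}(L_s(f_σ(1),…,f_σ(s)), f_σ(s+1),…,f_σ(s+r))` of the Jacobi expression, with
the outer bracket taken from `A` and the inner one from `B`. -/
def nestedBracket (A B : Polyvector K w) {n : ℕ} (f : Fin n → Functions K w) (s r : ℕ)
    (h : s + r = n) (σ : Equiv.Perm (Fin n)) : Functions K w :=
  bracket A (r + 1) (Fin.cons (bracket B s fun i => f (σ ⟨i, by omega⟩))
    fun k : Fin r => f (σ ⟨s + k, by omega⟩))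

/-- The sign of a summand in the Jacobi expression, `b` being the degree of the polyvector field in
the inner bracket. The term `b * s` is even for `b = 2`; it makes the sign compatible with replacing
that polyvector field by its image under the operator `• g`. -/
def jacobiSign {n : ℕ} (b : ℤ) (d : Fin n → ℤ) (s r : ℕ) (σ : Equiv.Perm (Fin n)) : ℤˣ :=
  skewKoszulSign d σ * (((r + 1 : ℕ) : ℤ) * ((s : ℤ) - 1) + b * s).negOnePow

theorem nestedBracket_congr (A B : Polyvector K w) {n : ℕ} (f : Fin n → Functions K w) {s r r' : ℕ}
    (hr : r = r') (h : s + r = n) (h' : s + r' = n) (σ : Equiv.Perm (Fin n)) :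
    nestedBracket A B f s r h σ = nestedBracket A B f s r' h' σ := by
  subst hr
  rfl

open Classical in
/-- The Jacobi expression with the outer bracket taken from `A` and the inner one from `B`, a
polyvector field of degree `b`. -/
def jacobiSum (A B : Polyvector K w) (b : ℤ) {n : ℕ} (d : Fin n → ℤ) (f : Fin n → Functions K w) :
    Functions K w :=
  ∑ s : Fin (n + 1), ∑ σ : Equiv.Perm (Fin n) with IsUnshuffle (s : ℕ) σ,
    jacobiSign b d s (n - s) σ • nestedBracket A B f s (n - s) (by omega) σ

theorem jacobiator_bracket (Γ : Polyvector K w) {n : ℕ} (d : Fin n → ℤ)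
    (f : Fin n → Functions K w) : jacobiator (bracket Γ) d f = jacobiSum Γ Γ 2 d f := by
  refine sum_congr rfl fun s _ => sum_congr rfl fun σ _ => ?_
  have h : jacobiSign 2 d s (n - s) σ = skewKoszulSign d σ *
      ((((n - (s : ℕ) + 1 : ℕ) : ℤ)) * (((s : ℕ) : ℤ) - 1)).negOnePow := by
    rw [jacobiSign, Int.negOnePow_add, Int.negOnePow_two_mul, mul_one]
  rw [h]
  rfl

/-- The last argument belongs to the outer bracket. -/
theorem jacobiTerm_insertPerm_last (A : Polyvector K w) {B : Polyvector K w} {b : ℤ}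
    (hB : B ∈ homogeneous K (polyDegree w) b) {n : ℕ} {d : Fin (n + 1) → ℤ}
    {f : Fin (n + 1) → Functions K w} (hf : ∀ i, f i ∈ homogeneous K w (d i)) {s r : ℕ}
    (h : s + r = n) (σ : Equiv.Perm (Fin n)) :
    jacobiSign b d s (r + 1) (insertPerm (Fin.last n) σ) •
        nestedBracket A B f s (r + 1) (by omega) (insertPerm (Fin.last n) σ) =
      (n + d (Fin.last n) * (n + 1 + b + ∑ i : Fin n, d i.castSucc)).negOnePow •
        (jacobiSign b (fun i => d i.castSucc) s r σ •
          nestedBracket (bullet A (incl (f (Fin.last n)))) B (fun i => f i.castSucc) s r h σ) := by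
  have hins : ∀ i (hi : i < n), insertPerm (Fin.last n) σ ⟨i, by omega⟩ = (σ ⟨i, hi⟩).castSucc :=
    fun i hi => by
      rw [← insertPerm_succAbove (Fin.last n), Fin.succAbove_last]
      rfl
  have hlast : insertPerm (Fin.last n) σ ⟨s + r, by omega⟩ = Fin.last n := by
    have hl : (⟨s + r, by omega⟩ : Fin (n + 1)) = Fin.last n := Fin.ext h
    rw [hl, insertPerm_self]
  set x := bracket B s fun i : Fin s => f (σ ⟨i, by omega⟩).castSucc with hx
  have hxm : x ∈ homogeneous K w (b - s + ∑ i : Fin s, d (σ ⟨i, by omega⟩).castSucc) :=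
    bracket_mem_homogeneous hB s fun i => hf _
  have e : nestedBracket A B f s (r + 1) (by omega) (insertPerm (Fin.last n) σ) =
      bracket A (r + 2) (Fin.snoc (α := fun _ => Functions K w)
        (Fin.cons x fun k : Fin r => f (σ ⟨s + k, by omega⟩).castSucc : Fin (r + 1) → _)
        (f (Fin.last n))) := by
    rw [nestedBracket, ← Fin.cons_snoc_eq_snoc_cons]
    congr 2
    · rw [hx]
      congr 1
      funext i
      rw [hins _ (by omega)]
    · funext k
      refine Fin.lastCases ?_ (fun k => ?_) k
      · simp only [Fin.snoc_last, Fin.val_last, hlast]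
      · simp only [Fin.snoc_castSucc, Fin.val_castSucc]
        rw [hins _ (by omega)]
  have hmem : ∀ i, (Fin.snoc (α := fun _ => Functions K w)
        (Fin.cons x fun k : Fin r => f (σ ⟨s + k, by omega⟩).castSucc : Fin (r + 1) → _)
        (f (Fin.last n)) : Fin (r + 2) → Functions K w) i ∈ homogeneous K w
      ((Fin.snoc (α := fun _ => ℤ) (Fin.cons (b - s + ∑ i : Fin s, d (σ ⟨i, by omega⟩).castSucc)
        fun k : Fin r => d (σ ⟨s + k, by omega⟩).castSucc : Fin (r + 1) → _)
        (d (Fin.last n)) : Fin (r + 2) → ℤ) i) := by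
    intro i
    refine Fin.lastCases ?_ (fun i => ?_) i
    · simpa only [Fin.snoc_last] using hf _
    · simp only [Fin.snoc_castSucc]
      refine Fin.cases ?_ (fun i => ?_) i
      · exact hxm
      · exact hf _
  rw [e, bracket_succ A (r + 1) hmem]
  simp only [Fin.snoc_castSucc, Fin.snoc_last]
  rw [nestedBracket, smul_smul, smul_smul, Fin.sum_univ_succ, jacobiSign, jacobiSign,
    skewKoszulSign_insertPerm]
  simp only [Fin.cons_zero, Fin.cons_succ, Fin.succAbove_last,
    (Fin.castSucc_lt_last _).not_gt, if_false, sum_const_zero, Int.negOnePow_zero, one_mul]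
  have hsum := (Equiv.sum_comp σ fun i => d i.castSucc).symm.trans
    (sum_eq_sum_blocks h fun i => d (σ i).castSucc)
  rw [mul_assoc, ← Int.negOnePow_add, mul_left_comm, ← Int.negOnePow_add, hsum]
  congr 2
  apply negOnePow_congr
  have hn : (n : ℤ) = s + r := by exact_mod_cast h.symm
  generalize (∑ i : Fin s, d (σ ⟨i, by omega⟩).castSucc) = S
  generalize (∑ k : Fin r, d (σ ⟨s + k, by omega⟩).castSucc) = R
  generalize d (Fin.last n) = g
  rw [hn]
  push_cast
  generalize (S : ZMod 2) = S, (R : ZMod 2) = R, (g : ZMod 2) = g, (b : ZMod 2) = b,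
    (s : ZMod 2) = s, (r : ZMod 2) = r
  decide +revert

/-- The last argument belongs to the inner bracket. -/
theorem jacobiTerm_insertPerm (A B : Polyvector K w) (b : ℤ)
    {n : ℕ} {d : Fin (n + 1) → ℤ}
    {f : Fin (n + 1) → Functions K w} (hf : ∀ i, f i ∈ homogeneous K w (d i)) {s r : ℕ}
    (h : s + r = n) (σ : Equiv.Perm (Fin n)) :
    jacobiSign b d (s + 1) r (insertPerm ⟨s, by omega⟩ σ) •
        nestedBracket A B f (s + 1) r (by omega) (insertPerm ⟨s, by omega⟩ σ) =
      (1 + b + d (Fin.last n) * ∑ i : Fin n, d i.castSucc).negOnePow •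
        (jacobiSign (b + d (Fin.last n) - 1) (fun i => d i.castSucc) s r σ •
          nestedBracket A (bullet B (incl (f (Fin.last n)))) (fun i => f i.castSucc) s r h σ) := by
  have hins1 : ∀ i (hi : i < s), insertPerm ⟨s, by omega⟩ σ ⟨i, by omega⟩ =
      (σ ⟨i, by omega⟩).castSucc := fun i hi => by
    rw [← insertPerm_succAbove ⟨s, by omega⟩]
    congr 1
    exact Fin.ext (by rw [val_succAbove, if_pos hi])
  have hins2 : ∀ k (hk : k < r), insertPerm ⟨s, by omega⟩ σ ⟨s + 1 + k, by omega⟩ =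
      (σ ⟨s + k, by omega⟩).castSucc := fun k hk => by
    rw [← insertPerm_succAbove ⟨s, by omega⟩]
    congr 1
    exact Fin.ext (by rw [val_succAbove, if_neg (by simp)]; simp only; omega)
  have hlast : insertPerm (⟨s, by omega⟩ : Fin (n + 1)) σ ⟨s, by omega⟩ = Fin.last n :=
    insertPerm_self _ σ
  have e : nestedBracket A B f (s + 1) r (by omega) (insertPerm ⟨s, by omega⟩ σ) =
      (s + d (Fin.last n) * (∑ i : Fin s, d (σ ⟨i, by omega⟩).castSucc + s)).negOnePow •
        nestedBracket A (bullet B (incl (f (Fin.last n)))) (fun i => f i.castSucc) s r h σ := by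
    rw [nestedBracket, bracket_succ B s fun i => hf _, bracket_cons_unit_smul, nestedBracket]
    simp only [Fin.val_last, Fin.val_castSucc, hlast, hins1 _ (Fin.is_lt _),
      hins2 _ (Fin.is_lt _)]
  have hsum := (Equiv.sum_comp σ fun i => d i.castSucc).symm.trans
    (sum_eq_sum_blocks h fun i => d (σ i).castSucc)
  have hins : (∑ j : Fin n, if (⟨s, by omega⟩ : Fin (n + 1)) < Fin.succAbove ⟨s, by omega⟩ j then
      1 + d (Fin.last n) * d (σ j).castSucc else 0) =
      r + d (Fin.last n) * ∑ k : Fin r, d (σ ⟨s + k, by omega⟩).castSucc := by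
    rw [sum_eq_sum_blocks h]
    have h1 : ∀ i : Fin s, ¬ (⟨s, by omega⟩ : Fin (n + 1)) <
        Fin.succAbove ⟨s, by omega⟩ (⟨i, by omega⟩ : Fin n) := fun i => by
      rw [Fin.lt_def, val_succAbove, if_pos i.2]
      exact i.2.not_gt
    have h2 : ∀ k : Fin r, (⟨s, by omega⟩ : Fin (n + 1)) <
        Fin.succAbove ⟨s, by omega⟩ (⟨s + k, by omega⟩ : Fin n) := fun k => by
      rw [Fin.lt_def, val_succAbove, if_neg (by simp)]
      simp only
      omega
    simp only [h1, h2, if_true, if_false, sum_const_zero, zero_add, sum_add_distrib, mul_sum]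
    simp
  rw [e, jacobiSign, jacobiSign, skewKoszulSign_insertPerm, hins, smul_smul, smul_smul,
    mul_right_comm, mul_right_comm _ (skewKoszulSign _ σ), ← Int.negOnePow_add,
    mul_right_comm (Int.negOnePow _) (skewKoszulSign _ σ), ← Int.negOnePow_add,
    mul_comm _ (skewKoszulSign _ σ), mul_left_comm (Int.negOnePow _) (skewKoszulSign _ σ),
    ← Int.negOnePow_add, hsum]
  congr 2
  apply negOnePow_congr
  generalize (∑ i : Fin s, d (σ ⟨i, by omega⟩).castSucc) = S
  generalize (∑ k : Fin r, d (σ ⟨s + k, by omega⟩).castSucc) = R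
  generalize d (Fin.last n) = g
  push_cast
  generalize (S : ZMod 2) = S, (R : ZMod 2) = R, (g : ZMod 2) = g, (b : ZMod 2) = b,
    (s : ZMod 2) = s, (r : ZMod 2) = r
  decide +revert

/-- The last argument of the Jacobi expression acts on one of the two polyvector fields. -/
theorem jacobiSum_succ (A : Polyvector K w) {B : Polyvector K w} {b : ℤ}
    (hB : B ∈ homogeneous K (polyDegree w) b) {n : ℕ} {d : Fin (n + 1) → ℤ}
    {f : Fin (n + 1) → Functions K w} (hf : ∀ i, f i ∈ homogeneous K w (d i)) :
    jacobiSum A B b d f =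
      (n + d (Fin.last n) * (n + 1 + b + ∑ i : Fin n, d i.castSucc)).negOnePow •
        jacobiSum (bullet A (incl (f (Fin.last n)))) B b (fun i => d i.castSucc)
          (fun i => f i.castSucc) +
      (1 + b + d (Fin.last n) * ∑ i : Fin n, d i.castSucc).negOnePow •
        jacobiSum A (bullet B (incl (f (Fin.last n)))) (b + d (Fin.last n) - 1)
          (fun i => d i.castSucc) fun i => f i.castSucc := by
  rw [jacobiSum, sum_isUnshuffle_succ, jacobiSum, jacobiSum, smul_sum, smul_sum]
  congr 1
  · refine sum_congr rfl fun s _ => ?_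
    rw [smul_sum]
    refine sum_congr rfl fun σ _ => ?_
    have hs : n + 1 - (s.castSucc : ℕ) = (n - s) + 1 := by
      have := s.2
      rw [Fin.val_castSucc]
      omega
    rw [← jacobiTerm_insertPerm_last A hB hf (by omega) σ]
    congr 1
    · rw [hs]
      rfl
    · exact nestedBracket_congr A B f hs _ _ _
  · refine sum_congr rfl fun s _ => ?_
    rw [smul_sum]
    refine sum_congr rfl fun σ _ => ?_
    have hs : n + 1 - (s.succ : ℕ) = n - s := by
      rw [Fin.val_succ]
      omega
    rw [← jacobiTerm_insertPerm A B b hf (by omega) σ]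
    congr 1
    · rw [hs]
      rfl
    · exact nestedBracket_congr A B f hs _ _ _

/-- Only the weight zero part of `B` contributes to the weight zero part of `A • B`. -/
theorem weightZero_bullet (A B : Polyvector K w) :
    weightZero (bullet A B) = weightZero (bullet A (incl (weightZero B))) := by
  simp only [bullet, map_sum, weightZero_mul, weightZero_derivLeft, weightZero_incl]

theorem jacobiSum_zero (A : Polyvector K w) {B : Polyvector K w} {b : ℤ}
    (hB : B ∈ homogeneous K (polyDegree w) b) (d : Fin 0 → ℤ) (f : Fin 0 → Functions K w) :
    jacobiSum A B b d f = -weightZero (bullet A B) := by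
  classical
  have hsign : ∀ σ : Equiv.Perm (Fin 0), jacobiSign b d 0 0 σ = -1 := fun σ => by
    rw [jacobiSign, skewKoszulSign_eq]
    simp
  have hnest : ∀ σ : Equiv.Perm (Fin 0), nestedBracket A B f 0 0 rfl σ =
      weightZero (bullet A B) := fun σ => by
    rw [nestedBracket, bracket_zero, weightZero_bullet,
      bracket_succ A 0 (d := fun _ => b) fun i => by
        rw [Fin.fin_one_eq_zero i]
        exact weightZero_mem_homogeneous hB,
      bracket_zero]
    simp
  rw [jacobiSum, Fin.sum_univ_one, filter_true_of_mem fun σ _ =>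
    ⟨fun i => i.elim0, fun i => i.elim0⟩, univ_unique, sum_singleton]
  refine (congrArg₂ _ (hsign _) (hnest _)).trans ?_
  rw [Units.neg_smul, one_smul]

/-- The Jacobi expression is the bracket of the Schouten bracket: the Jacobi expressions of `A`, `B`
and of `B`, `A` add up to the bracket defined by `[A, B]_S`. -/
theorem jacobiSum_add_jacobiSum {A B : Polyvector K w} {a b : ℤ}
    (hA : A ∈ homogeneous K (polyDegree w) a) (hB : B ∈ homogeneous K (polyDegree w) b) {n : ℕ}
    {d : Fin n → ℤ} {f : Fin n → Functions K w} (hf : ∀ i, f i ∈ homogeneous K w (d i)) :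
    (n * (1 + b)).negOnePow • jacobiSum A B b d f +
      (a * b + a + b + n * (1 + a)).negOnePow • jacobiSum B A a d f =
      -bracket (schouten a b A B) n f := by
  induction n generalizing A B a b with
  | zero =>
    rw [jacobiSum_zero A hB, jacobiSum_zero B hA]
    simp only [bracket_zero, schouten, map_add, map_unit_smul, Nat.cast_zero,
      zero_mul, add_zero, Int.negOnePow_zero, one_smul, smul_neg, neg_add]
  | succ n ih =>
    have hg := hf (Fin.last n)
    have hA' := homogeneous_congr (q := a + d (Fin.last n) - 1)
      (bullet_mem_homogeneous hA (incl_mem_homogeneous hg)) rfl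
    have hB' := homogeneous_congr (q := b + d (Fin.last n) - 1)
      (bullet_mem_homogeneous hB (incl_mem_homogeneous hg)) rfl
    have h1 := ih hA' hB fun i => hf i.castSucc
    have h2 := ih hA hB' fun i => hf i.castSucc
    rw [jacobiSum_succ A hB hf, jacobiSum_succ B hA hf, bracket_succ _ n hf,
      bullet_schouten_incl hA hB hg, bracket_add, bracket_unit_smul]
    -- Solve the induction hypotheses for the brackets.
    rw [eq_neg_iff_add_eq_zero, add_comm, ← eq_neg_iff_add_eq_zero] at h1 h2
    rw [h1, h2]
    simp only [smul_add, smul_neg, smul_smul, neg_add, neg_neg, ← Int.negOnePow_add]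
    generalize d (Fin.last n) = g
    generalize ∑ i : Fin n, d i.castSucc = D
    have reorder : ∀ x y z t : Functions K w, y + z + (x + t) = x + y + (z + t) :=
      fun x y z t => by abel
    refine Eq.trans ?_ (reorder _ _ _ _).symm
    congr 3 <;> apply negOnePow_congr <;> push_cast <;>
    generalize (a : ZMod 2) = a, (b : ZMod 2) = b, (g : ZMod 2) = g, (D : ZMod 2) = D,
      (n : ZMod 2) = n <;>
    decide +revert

theorem jacobiator_bracket_eq_zero_iff [CharZero K] {Γ : Polyvector K w}
    (hΓ : Γ ∈ homogeneous K (polyDegree w) 2) {n : ℕ}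
    {d : Fin n → ℤ} {f : Fin n → Functions K w} (hf : ∀ i, f i ∈ homogeneous K w (d i)) :
    jacobiator (bracket Γ) d f = 0 ↔ bracket (schouten 2 2 Γ Γ) n f = 0 := by
  rw [jacobiator_bracket, ← neg_eq_zero (a := bracket _ _ _), ← jacobiSum_add_jacobiSum hΓ hΓ hf]
  have e : ((2 : ℤ) * 2 + 2 + 2 + n * (1 + 2)).negOnePow = ((n : ℤ) * (1 + 2)).negOnePow := by
    rw [Int.negOnePow_add, Int.negOnePow_even _ (by decide), one_mul]
  rw [e, ← smul_add, smul_eq_zero_iff_eq, ← two_smul K, smul_eq_zero_iff_right two_ne_zero]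

theorem isLInfinity_bracket_iff [CharZero K] {Γ : Polyvector K w} (hΓ : HasPositiveWeight Γ) :
    IsLInfinity (homogeneous K w) (bracket Γ) ↔ IsExtendedPoisson Γ := by
  constructor
  · intro h
    have hdeg : Γ ∈ homogeneous K (polyDegree w) 2 := mem_homogeneous_of_bracket_var fun n a =>
      homogeneous_congr (h.degree n (fun i => w (a i)) _ fun i => var_mem_homogeneous _)
        (add_comm _ _)
    exact ⟨hΓ, hdeg, eq_zero_of_bracket_var fun n a =>
      (jacobiator_bracket_eq_zero_iff hdeg fun i => var_mem_homogeneous (a i)).1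
        (h.jacobi n _ _ fun i => var_mem_homogeneous _)⟩
  · intro h
    exact ⟨fun n d f hf σ => bracket_perm Γ n hf σ,
      fun n d f hf => homogeneous_congr (bracket_mem_homogeneous h.degree n hf) (add_comm _ _),
      fun n d f hf => (jacobiator_bracket_eq_zero_iff h.degree hf).2 (by
        rw [h.schouten_eq_zero, bracket_eq_sum]
        simp)⟩

end FormalGraded

end

theorem mainTheorem7 {K : Type*} [Field K] [CharZero K]
    {V : Type*} [AddCommGroup V] [Module K V]
    (𝒱 : ℤ → Submodule K V) (_h𝒱 : DirectSum.IsInternal 𝒱)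
    {ι : Type*} [Fintype ι] [LinearOrder ι]
    (e : Module.Basis ι K V) (deg : ι → ℤ) (_he : ∀ a, e a ∈ 𝒱 (deg a))
    (Γ : FormalGraded.Polyvector K (fun a => -deg a))
    (_hΓ : FormalGraded.HasPositiveWeight Γ) :
    (∀ n : ℕ, FormalGraded.IsGradedSkew
        (FormalGraded.SuperSeries.homogeneous K (fun a => -deg a))
        (FormalGraded.bracket Γ n)) ∧
    (∀ n : ℕ, FormalGraded.IsGradedLeibnizRight (FormalGraded.bracket Γ n)) ∧
    (∀ k : ℤ,
      Γ ∈ FormalGraded.SuperSeries.homogeneous K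
          (FormalGraded.polyDegree (fun a => -deg a)) k →
        ∀ n : ℕ, FormalGraded.IsGradedLeibniz (k - n) (FormalGraded.bracket Γ n)) ∧
    (FormalGraded.IsLInfinity
        (FormalGraded.SuperSeries.homogeneous K (fun a => -deg a))
        (FormalGraded.bracket Γ) ↔
      FormalGraded.IsExtendedPoisson Γ) :=
  ⟨fun n _ _ hf σ => FormalGraded.bracket_perm Γ n hf σ,
    fun n => FormalGraded.isGradedLeibnizRight_bracket Γ n,
    fun _ hk n => FormalGraded.isGradedLeibniz_bracket hk n,
    FormalGraded.isLInfinity_bracket_iff _hΓ⟩
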